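/- Let $k>3$. Label the tiles of a $k\times(k+1)$ rectangle ($k$ rows, $k+1$ columns) by $(i,j)$ with $1\le i\le k$ (row, from the top) and $1\le j\le k+1$ (column, from the left). Let $\sigma_L$ and $\sigma_R$ be the permutations of the tiles given by the clockwise $90^\circ$ rotations of the left and of the right $k\times k$ square: \[ \sigma_L(i,j)=\begin{cases}(j,k+1-i)& j\ne k+1\\ (i,k+1)& j=k+1,\end{cases}\qquad \sigma_R(i,j)=\begin{cases}(j-1,k+2-i)& j\ne 1\\ (i,1)& j=1.\end{cases} \] Products of permutations are compositions, the right factor being applied first. Then the group $\langle\sigma_L,\sigma_R\rangle$ contains a $3$-cycle. More precisely: (1) If $k$ is even, put $y=(\sigma_R^2\sigma_L^2)^{\lceil k/4\rceil}$, and let $\sigma_3=\sigma_R$ if $k\equiv0 \pmod 4$ and $\sigma_3=\sigma_L$ if $k\equiv 2\pmod 4$. Then \[ \Big(\,y\,\sigma_3\,y^{-1}\,(\sigma_R^{-1}\sigma_L^{-1})^2\Big)^{20} \] is a $3$-cycle. (2) If $k$ is odd, let \[ \alpha=\begin{cases}3& k\not\equiv 3\pmod{18}\\ 4& k\equiv 3\pmod{72}\\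 2& k\equiv 21,57\pmod{72}\\ 12& k\equiv 39\pmod{72},\end{cases} \] let $w=(\sigma_R^{-1}\sigma_L)^{\alpha}(\sigma_R^2\sigma_L^2)^{(k-1)/2}\sigma_L^2$ and let $\beta$ be the order of $w$. Then $3\mid\beta$ and $w^{\beta/3}$ is a $3$-cycle. Let $w'$ be obtained from $w$ by swapping $\sigma_L$ and $\sigma_R$, and let $\beta'$ be its order. Then also $3\mid\beta'$ and $(w')^{\beta'/3}$ is a $3$-cycle. The tiles moved by $w^{\beta/3}$ all lie in one of the two checkerboard colour classes (given by the parity of $i+j$), and the tiles moved by $(w')^{\beta'/3}$ all lie in the other. -/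

import Mathlib

/-- The tiles of the `k × (k+1)` rectangle: `(i, j)` is the tile in row `i` (counted from the top)
and column `j` (counted from the left). Rows and columns are counted from `0`. -/
abbrev Tile (k : ℕ) : Type := Fin k × Fin (k + 1)

/-- The clockwise rotation of the left `k × k` square (columns `0, …, k-1`), fixing the last
column. In coordinates counted from `1` it sends `(i, j)` to `(j, k+1-i)`. -/
def sigmaL (k : ℕ) : Equiv.Perm (Tile k) where
  toFun t :=
    if h : (t.2 : ℕ) < k then (⟨t.2, h⟩, ⟨k - 1 - t.1, by omega⟩) else t
  invFun t :=
    if h : (t.2 : ℕ) < k then (⟨k - 1 - t.2, by omega⟩, ⟨t.1, by omega⟩) else t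
  left_inv := by
    rintro ⟨i, j⟩
    by_cases h : (j : ℕ) < k
    · have h2 : k - 1 - (i : ℕ) < k := by omega
      have h3 : k - 1 - (k - 1 - (i : ℕ)) = i := by omega
      simp [h, h2, h3]
    · simp [h]
  right_inv := by
    rintro ⟨i, j⟩
    by_cases h : (j : ℕ) < k
    · have h3 : k - 1 - (k - 1 - (j : ℕ)) = j := by omega
      simp [h, h3]
    · simp [h]

/-- The clockwise rotation of the right `k × k` square (columns `1, …, k`), fixing the first
column. In coordinates counted from `1` it sends `(i, j)` to `(j-1, k+2-i)`. -/
def sigmaR (k : ℕ) : Equiv.Perm (Tile k) where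
  toFun t :=
    if h : 0 < (t.2 : ℕ) then (⟨t.2 - 1, by omega⟩, ⟨k - t.1, by omega⟩) else t
  invFun t :=
    if h : 0 < (t.2 : ℕ) then (⟨k - t.2, by omega⟩, ⟨t.1 + 1, by omega⟩) else t
  left_inv := by
    rintro ⟨i, j⟩
    by_cases h : 0 < (j : ℕ)
    · have h2 : 0 < k - (i : ℕ) := by omega
      have h3 : k - (k - (i : ℕ)) = i := by omega
      have h4 : (j : ℕ) - 1 + 1 = j := by omega
      simp only [h, h2, h3, h4, dite_true]
    · simp [h]
  right_inv := by
    rintro ⟨i, j⟩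
    by_cases h : 0 < (j : ℕ)
    · have h3 : k - (k - (j : ℕ)) = j := by omega
      simp [h, h3]
    · simp [h]

/-- The puzzle group of the `k × (k+1)` rectangle. -/
def puzzleGroup (k : ℕ) : Subgroup (Equiv.Perm (Tile k)) :=
  Subgroup.closure {sigmaL k, sigmaR k}

/-- The two colour classes of the checkerboard colouring; `c` is the parity of `i + j`. -/
def colourClass (k : ℕ) (c : ZMod 2) : Set (Tile k) :=
  {t | (((t.1 : ℕ) + (t.2 : ℕ) : ℕ) : ZMod 2) = c}

/-- The word used for even `k`: the conjugate `y σ₃ y⁻¹` times `(r⁻¹ l⁻¹)²`, where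
`y = (r² l²) ^ ⌈k/4⌉` and `σ₃` is `r` if `4 ∣ k` and `l` otherwise. -/
def evenWord {G : Type*} [Group G] (k : ℕ) (l r : G) : G :=
  let y : G := (r ^ 2 * l ^ 2) ^ ⌈(k : ℚ) / 4⌉₊
  let s : G := if k % 4 = 0 then r else l
  (y * s * y⁻¹) * (r⁻¹ * l⁻¹) ^ 2

/-- The exponent `α`; since `k ≡ 3 mod 18` leaves only the residues `3, 21, 39, 57` modulo `72`,
the last branch is `k ≡ 39 mod 72`. -/
def alphaExp (k : ℕ) : ℕ :=
  if k % 18 ≠ 3 then 3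
  else if k % 72 = 3 then 4
  else if k % 72 = 21 ∨ k % 72 = 57 then 2
  else 12

/-- The word used for odd `k`. -/
def oddWord {G : Type*} [Group G] (k : ℕ) (l r : G) : G :=
  (r⁻¹ * l) ^ alphaExp k * (r ^ 2 * l ^ 2) ^ ((k - 1) / 2) * l ^ 2

/-! The words are explicit enough that every cycle can be followed in integer coordinates.

Even k = 2h. The factor (r⁻¹ l⁻¹)² moves only tiles of the top row and of the two outer columns, and
y σ₃ y⁻¹ rotates the four h × h quadrants about the middle column. Their product (`evenWord_moves`)
permutes three tiles cyclically. Every other orbit closes up after 1, 4 or 10 steps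
(`fixed_of_not_special`), so the twentieth power kills all but the 3-cycle.

Odd k. The factor after (r⁻¹ l)^α mirrors the columns 0, …, k-3, and (r⁻¹ l)^α pushes tiles α steps
along diagonals. Hence a tile in the columns α, …, k-3 descends α rows per step, alternating between
two mirror columns, until it leaves through the bottom and reappears at the left border. From there
one or two steps bring it back to the top α rows (`conn_pass`, `conn_left_low`, `conn_left_high`).
This gives a simple first-return map on the top rows.

Three tiles always form a 3-cycle (`special_moves`). By `pow_orderOf_div_three` it suffices that
every other tile returns after a number of steps prime to 3, so steps are counted only modulo 3
(`Conn`, `Good`). With α = 3 this fails exactly when k ≡ 3 modulo 18, where the other values of α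
take over. Generic tiles are treated with the return map; those near the border by evaluating orbits
symbolically, uniformly in k, in a finite computation.

The half turn of the rectangle conjugates l to r and exchanges the two colours for odd k, which
settles the swapped word. -/

/-! ### Tiles and moves in integer coordinates. -/

/-- `AtPos t i j`: the tile `t` lies in row `i` and column `j`, as integers. -/
def AtPos {k : ℕ} (t : Tile k) (i j : ℤ) : Prop := (t.1 : ℤ) = i ∧ (t.2 : ℤ) = j

lemma AtPos.bounds {k : ℕ} {t : Tile k} {i j : ℤ} (h : AtPos t i j) :
    0 ≤ i ∧ i < k ∧ 0 ≤ j ∧ j ≤ k := by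
  obtain ⟨⟨a, ha⟩, ⟨b, hb⟩⟩ := t
  obtain ⟨h1, h2⟩ := h
  simp only at h1 h2
  omega

lemma AtPos.unique {k : ℕ} {t t' : Tile k} {i j : ℤ} (h : AtPos t i j) (h' : AtPos t' i j) :
    t = t' := by
  obtain ⟨h1, h2⟩ := h
  obtain ⟨h3, h4⟩ := h'
  refine Prod.ext (Fin.ext ?_) (Fin.ext ?_)
  · exact_mod_cast h1.trans h3.symm
  · exact_mod_cast h2.trans h4.symm

lemma exists_atPos {k : ℕ} {i j : ℤ} (hi : 0 ≤ i) (hi' : i < k) (hj : 0 ≤ j) (hj' : j ≤ k) :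
    ∃ t : Tile k, AtPos t i j :=
  ⟨(⟨i.toNat, by omega⟩, ⟨j.toNat, by omega⟩), by
    constructor <;> simp [hi, hj]⟩

/-- `Moves f i j i' j'`: the permutation `f` moves the tile at `(i, j)` to `(i', j')`. -/
def Moves {k : ℕ} (f : Equiv.Perm (Tile k)) (i j i' j' : ℤ) : Prop :=
  ∀ t, AtPos t i j → AtPos (f t) i' j'

section Moves

variable {k : ℕ} {f g : Equiv.Perm (Tile k)} {i j i' j' i'' j'' : ℤ}

lemma Moves.mul (hg : Moves g i j i' j') (hf : Moves f i' j' i'' j'') :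
    Moves (f * g) i j i'' j'' := fun t ht => hf _ (hg t ht)

lemma Moves.one : Moves (1 : Equiv.Perm (Tile k)) i j i j := fun _ ht => ht

/-- The bounds concern the source: `Moves` is vacuous off the board, so a tile at the source must
exist for the inverse to be determined. -/
lemma Moves.inv (hi : 0 ≤ i) (hi' : i < k) (hj : 0 ≤ j) (hj' : j ≤ k)
    (hf : Moves f i j i' j') : Moves f⁻¹ i' j' i j := by
  intro t ht
  obtain ⟨s, hs⟩ := exists_atPos hi hi' hj hj'
  have : f s = t := (hf s hs).unique ht
  rw [← this]
  simpa using hs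

lemma Moves.apply_eq {t : Tile k} (h : Moves f i j i j) (ht : AtPos t i j) : f t = t :=
  (h t ht).unique ht

lemma Moves.cast {a b : ℤ} (h : Moves f i j i' j') (ha : a = i') (hb : b = j') :
    Moves f i j a b := by
  subst ha hb; exact h

end Moves

/-! ### The rotations, the column shift and the diagonal flow. -/

section Rotations

variable {k : ℕ} {i j i' j' : ℤ}

lemma sigmaL_moves
    (h : (j < k ∧ i' = j ∧ j' = k - 1 - i) ∨ (j = k ∧ i' = i ∧ j' = k)) :
    Moves (sigmaL k) i j i' j' := by
  rintro ⟨⟨a, ha⟩, ⟨b, hb⟩⟩ ⟨h1, h2⟩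
  simp only at h1 h2
  by_cases hb' : b < k
  · simp only [AtPos, sigmaL, Equiv.coe_fn_mk, hb', dite_true]
    omega
  · simp only [AtPos, sigmaL, Equiv.coe_fn_mk, hb', dite_false]
    omega

lemma sigmaR_moves
    (h : (0 < j ∧ i' = j - 1 ∧ j' = k - i) ∨ (j = 0 ∧ i' = i ∧ j' = 0)) :
    Moves (sigmaR k) i j i' j' := by
  rintro ⟨⟨a, ha⟩, ⟨b, hb⟩⟩ ⟨h1, h2⟩
  simp only at h1 h2
  by_cases hb' : 0 < b
  · simp only [AtPos, sigmaR, Equiv.coe_fn_mk, hb', dite_true]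
    omega
  · simp only [AtPos, sigmaR, Equiv.coe_fn_mk, hb', dite_false]
    omega

lemma sigmaL_inv_moves
    (h : (j < k ∧ i' = k - 1 - j ∧ j' = i) ∨ (j = k ∧ i' = i ∧ j' = k)) :
    Moves (sigmaL k)⁻¹ i j i' j' := by
  intro t ht
  have := ht.bounds
  exact Moves.inv (by omega) (by omega) (by omega) (by omega)
    (sigmaL_moves (k := k) (i := i') (j := j') (i' := i) (j' := j) (by omega)) t ht

lemma sigmaR_inv_moves
    (h : (0 < j ∧ i' = k - j ∧ j' = i + 1) ∨ (j = 0 ∧ i' = i ∧ j' = 0)) :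
    Moves (sigmaR k)⁻¹ i j i' j' := by
  intro t ht
  have := ht.bounds
  exact Moves.inv (by omega) (by omega) (by omega) (by omega)
    (sigmaR_moves (k := k) (i := i') (j := j') (i' := i) (j' := j) (by omega)) t ht

lemma sigmaL_sq_moves
    (h : (j < k ∧ i' = k - 1 - i ∧ j' = k - 1 - j) ∨ (j = k ∧ i' = i ∧ j' = k)) :
    Moves (sigmaL k ^ 2) i j i' j' := by
  intro t ht
  have := ht.bounds
  rw [pow_two]
  rcases h with h | h
  · exact (Moves.mul (i' := j) (j' := k - 1 - i) (sigmaL_moves (by omega))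
      (sigmaL_moves (by omega))) t ht
  · exact (Moves.mul (i' := i) (j' := k) (sigmaL_moves (by omega))
      (sigmaL_moves (by omega))) t ht

lemma sigmaR_sq_moves
    (h : (0 < j ∧ i' = k - 1 - i ∧ j' = k + 1 - j) ∨ (j = 0 ∧ i' = i ∧ j' = 0)) :
    Moves (sigmaR k ^ 2) i j i' j' := by
  intro t ht
  have := ht.bounds
  rw [pow_two]
  rcases h with h | h
  · exact (Moves.mul (i' := j - 1) (j' := k - i) (sigmaR_moves (by omega))
      (sigmaR_moves (by omega))) t ht
  · exact (Moves.mul (i' := i) (j' := 0) (sigmaR_moves (by omega))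
      (sigmaR_moves (by omega))) t ht

/-- `σ_R² σ_L²` shifts the columns cyclically by two, and reflects the rows on wrapping round. -/
lemma shift_moves
    (h : (j + 2 ≤ k ∧ i' = i ∧ j' = j + 2) ∨ (k < j + 2 ∧ i' = k - 1 - i ∧ j' = j + 1 - k)) :
    Moves (sigmaR k ^ 2 * sigmaL k ^ 2) i j i' j' := by
  intro t ht
  have := ht.bounds
  by_cases hj : j = k
  · exact (Moves.mul (i' := i) (j' := k) (sigmaL_sq_moves (by omega))
      (sigmaR_sq_moves (by omega))) t ht
  · exact (Moves.mul (i' := k - 1 - i) (j' := k - 1 - j) (sigmaL_sq_moves (by omega))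
      (sigmaR_sq_moves (by omega))) t ht

/-- The bound on `n` allows a tile to wrap round at most once, hence at most one reflection of its
row. -/
lemma shift_pow_moves (n : ℕ) (hn : 2 * n ≤ k + 1)
    (h : (j + 2 * n ≤ k ∧ i' = i ∧ j' = j + 2 * n) ∨
      (k < j + 2 * n ∧ i' = k - 1 - i ∧ j' = j + 2 * n - (k + 1))) :
    Moves ((sigmaR k ^ 2 * sigmaL k ^ 2) ^ n) i j i' j' := by
  induction n generalizing i' j' with
  | zero =>
    intro t ht
    have := ht.bounds
    obtain ⟨rfl, rfl⟩ : i' = i ∧ j' = j := by simp at h; omega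
    simpa using ht
  | succ n ih =>
    rw [pow_succ']
    intro t ht
    have := ht.bounds
    push_cast at h
    by_cases hj : j + 2 * n ≤ k
    · exact (Moves.mul (ih (i' := i) (j' := j + 2 * n) (by omega) (by omega))
        (shift_moves (by omega))) t ht
    · exact (Moves.mul (ih (i' := k - 1 - i) (j' := j + 2 * n - (k + 1)) (by omega) (by omega))
        (shift_moves (by omega))) t ht

/-- The effect of `n` steps of the diagonal flow `σ_R⁻¹ σ_L`, for `n ≤ k`. -/
def DiagRel (k : ℕ) (n : ℤ) (i j i' j' : ℤ) : Prop :=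
  (j ≤ i ∧ i + n ≤ k - 1 ∧ i' = i + n ∧ j' = j + n) ∨
  (j ≤ i ∧ k ≤ i + n ∧ j + n ≤ k ∧ i' = j + n - 1 ∧ j' = i + n - k) ∨
  (i < j ∧ j + n ≤ k ∧ i' = i + n ∧ j' = j + n) ∨
  (i < j ∧ k < j + n ∧ i + n ≤ k ∧ i' = j + n - k - 1 ∧ j' = i + n) ∨
  (k < i + n ∧ k < j + n ∧ i' = i + n - k - 1 ∧ j' = j + n - k - 1)

/-- A tile goes one place down and to the right. From the bottom row, (k-1, j) with j < k re-enters
at (j, 0); from the last column, (i, k) re-enters at (0, i+1). -/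
lemma diag_moves (h : DiagRel k 1 i j i' j') :
    Moves ((sigmaR k)⁻¹ * sigmaL k) i j i' j' := by
  intro t ht
  have := ht.bounds
  unfold DiagRel at h
  by_cases hj : j = k
  · exact (Moves.mul (i' := i) (j' := k) (sigmaL_moves (by omega))
      (sigmaR_inv_moves (by omega))) t ht
  · exact (Moves.mul (i' := j) (j' := k - 1 - i) (sigmaL_moves (by omega))
      (sigmaR_inv_moves (by omega))) t ht

lemma DiagRel.total {n : ℤ} (i j : ℤ) : ∃ i' j', DiagRel k n i j i' j' := by
  unfold DiagRel
  by_cases h1 : j ≤ i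
  · by_cases h2 : i + n ≤ k - 1
    · exact ⟨_, _, Or.inl ⟨h1, h2, rfl, rfl⟩⟩
    · by_cases h3 : j + n ≤ k
      · exact ⟨_, _, Or.inr (Or.inl ⟨h1, by omega, h3, rfl, rfl⟩)⟩
      · by_cases h4 : k < i + n
        · exact ⟨_, _, Or.inr (Or.inr (Or.inr (Or.inr ⟨h4, by omega, rfl, rfl⟩)))⟩
        · omega
  · by_cases h2 : j + n ≤ k
    · exact ⟨_, _, Or.inr (Or.inr (Or.inl ⟨by omega, h2, rfl, rfl⟩))⟩
    · by_cases h3 : i + n ≤ k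
      · exact ⟨_, _, Or.inr (Or.inr (Or.inr (Or.inl ⟨by omega, by omega, h3, rfl, rfl⟩)))⟩
      · exact ⟨_, _, Or.inr (Or.inr (Or.inr (Or.inr ⟨by omega, by omega, rfl, rfl⟩)))⟩

lemma diag_pow_moves (n : ℕ) (hn : n ≤ k) (h : DiagRel k n i j i' j') :
    Moves (((sigmaR k)⁻¹ * sigmaL k) ^ n) i j i' j' := by
  induction n generalizing i' j' with
  | zero =>
    intro t ht
    have := ht.bounds
    unfold DiagRel at h
    obtain ⟨rfl, rfl⟩ : i' = i ∧ j' = j := by push_cast at h; omega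
    simpa using ht
  | succ n ih =>
    rw [pow_succ']
    intro t ht
    have := ht.bounds
    obtain ⟨a, b, hab⟩ := DiagRel.total (k := k) (n := n) i j
    refine (Moves.mul (ih (by omega) hab) (diag_moves ?_)) t ht
    unfold DiagRel at *
    push_cast at h
    rcases hab with hab | hab | hab | hab | hab <;> rcases h with h | h | h | h | h <;>
      first
        | (exfalso; omega)
        | omega

/-- The word `(σ_R⁻¹ σ_L)^α (σ_R² σ_L²)^((k-1)/2) σ_L²`. -/
def flowWord (k α : ℕ) : Equiv.Perm (Tile k) :=
  ((sigmaR k)⁻¹ * sigmaL k) ^ α * (sigmaR k ^ 2 * sigmaL k ^ 2) ^ ((k - 1) / 2) * sigmaL k ^ 2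

/-- One application of `flowWord k α` in coordinates, for `k` odd. -/
def StepRel (k : ℕ) (α : ℤ) (i j i' j' : ℤ) : Prop :=
  (j ≤ k - 3 ∧ DiagRel k α i (k - 3 - j) i' j') ∨
  (j = k - 2 ∧ DiagRel k α (k - 1 - i) k i' j') ∨
  (j = k - 1 ∧ DiagRel k α (k - 1 - i) (k - 1) i' j') ∨
  (j = k ∧ DiagRel k α (k - 1 - i) (k - 2) i' j')

/-- The shift by k-1 columns is a shift by -2 modulo k+1. Combined with σ_L² it sends column j ≤ k-3
to k-3-j, the two row reflections cancelling; in the last three columns j becomes 2k-2-j and the row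
is reflected. The diagonal flow is applied to the result. -/
lemma flowWord_moves {α : ℕ} (hk : Odd k) (hk2 : 2 ≤ k) (hα : α ≤ k)
    (h : StepRel k α i j i' j') : Moves (flowWord k α) i j i' j' := by
  obtain ⟨m, hm⟩ := hk
  intro t ht
  have := ht.bounds
  have hm' : (k - 1) / 2 = m := by omega
  unfold flowWord
  rw [hm', mul_assoc]
  rcases h with ⟨h1, h⟩ | ⟨h1, h⟩ | ⟨h1, h⟩ | ⟨h1, h⟩
  · refine (Moves.mul (Moves.mul (sigmaL_sq_moves (i' := k - 1 - i) (j' := k - 1 - j) ?_)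
      (shift_pow_moves m ?_ ?_)) (diag_pow_moves α hα h)) t ht <;> omega
  · refine (Moves.mul (Moves.mul (sigmaL_sq_moves (i' := k - 1 - i) (j' := k - 1 - j) ?_)
      (shift_pow_moves m ?_ ?_)) (diag_pow_moves α hα h)) t ht <;> omega
  · refine (Moves.mul (Moves.mul (sigmaL_sq_moves (i' := k - 1 - i) (j' := k - 1 - j) ?_)
      (shift_pow_moves m ?_ ?_)) (diag_pow_moves α hα h)) t ht <;> omega
  · refine (Moves.mul (Moves.mul (sigmaL_sq_moves (i' := i) (j' := k) ?_)
      (shift_pow_moves m ?_ ?_)) (diag_pow_moves α hα h)) t ht <;> omega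

end Rotations

/-! ### Extracting a 3-cycle as a power. -/

section ThreeCycles

variable {T : Type*} {f : Equiv.Perm T} {a b c : T}

lemma isThreeCycle_of_fixes_compl [Fintype T] [DecidableEq T] (hab : a ≠ b) (hac : a ≠ c) (hbc : b ≠ c)
    (ha : f a ≠ a) (hb : f b ≠ b) (hc : f c ≠ c)
    (hf : ∀ t, t ≠ a → t ≠ b → t ≠ c → f t = t) :
    f.IsThreeCycle ∧ f.support = {a, b, c} := by
  have hs : f.support = {a, b, c} := by
    ext t
    simp only [Equiv.Perm.mem_support, Finset.mem_insert, Finset.mem_singleton]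
    constructor
    · intro h
      by_contra! h'
      exact h (hf t h'.1 h'.2.1 h'.2.2)
    · rintro (rfl | rfl | rfl) <;> assumption
  refine ⟨?_, hs⟩
  rw [← card_support_eq_three_iff, hs]
  exact Finset.card_eq_three.2 ⟨a, b, c, hab, hac, hbc, rfl⟩

lemma pow_apply_ne_of_three_cycle (hab : f a = b) (hbc : f b = c) (hca : f c = a)
    (h1 : a ≠ b) (h2 : a ≠ c) {n : ℕ} (hn : ¬ 3 ∣ n) : (f ^ n) a ≠ a := by
  have h3 : (f ^ 3) a = a := by
    simp [pow_succ, hab, hbc, hca]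
  have h3m : ∀ m, ((f ^ 3) ^ m) a = a := by
    intro m
    induction m with
    | zero => simp
    | succ m ih => rw [pow_succ, Equiv.Perm.mul_apply, h3, ih]
  obtain ⟨q, hq | hq⟩ : ∃ q, n = 3 * q + 1 ∨ n = 3 * q + 2 := ⟨n / 3, by omega⟩
  · rw [hq, add_comm, pow_add, pow_mul, Equiv.Perm.mul_apply, h3m, pow_one, hab]
    exact h1.symm
  · rw [hq, add_comm, pow_add, pow_mul, Equiv.Perm.mul_apply, h3m, pow_two,
      Equiv.Perm.mul_apply, hab, hbc]
    exact h2.symm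

/-- If `f` permutes `a, b, c` cyclically and all its other cycles have length prime to `3`, then
the power of `f` with exponent a third of its order is a `3`-cycle on `a, b, c`. -/
lemma pow_orderOf_div_three [Fintype T] [DecidableEq T] (hab : f a = b) (hbc : f b = c) (hca : f c = a)
    (h1 : a ≠ b) (h2 : a ≠ c) (h3 : b ≠ c)
    (hf : ∀ t, t ≠ a → t ≠ b → t ≠ c → ∃ n : ℤ, ¬ 3 ∣ n ∧ (f ^ n) t = t) :
    3 ∣ orderOf f ∧ (f ^ (orderOf f / 3)).IsThreeCycle ∧
      (f ^ (orderOf f / 3)).support = {a, b, c} := by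
  have hdvd : 3 ∣ orderOf f := by
    by_contra h
    exact pow_apply_ne_of_three_cycle hab hbc hca h1 h2 h (by rw [pow_orderOf_eq_one]; rfl)
  refine ⟨hdvd, ?_⟩
  obtain ⟨m, hm⟩ := hdvd
  have hpos : 0 < orderOf f := orderOf_pos f
  have hm3 : orderOf f / 3 = m := by omega
  rw [hm3]
  have hfix : ∀ t, t ≠ a → t ≠ b → t ≠ c → (f ^ m) t = t := by
    intro t hta htb htc
    obtain ⟨n, hn, hnt⟩ := hf t hta htb htc
    -- Bézout: with u n + 3 v = 1 and order 3m, one has m = (m u) n + v · 3m, so `f ^ m` is a power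
    -- of `f ^ n` and fixes `t`.
    have hcop : IsCoprime n 3 :=
      ((Nat.prime_three.coprime_iff_not_dvd).2 (by
        rwa [← Int.natCast_dvd, Nat.cast_ofNat]) |>.symm |> fun h => by
          rw [Int.isCoprime_iff_gcd_eq_one]; exact h)
    obtain ⟨u, v, huv⟩ := hcop
    have hmt : (m : ℤ) = (m * u) * n + v * orderOf f := by
      rw [hm]; push_cast; linear_combination (-(m : ℤ)) * huv
    have : f ^ m = (f ^ n) ^ (m * u) := by
      calc f ^ m = f ^ (n * (m * u) + orderOf f * v) := by
            rw [← zpow_natCast]; congr 1; linear_combination hmt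
        _ = (f ^ n) ^ (m * u) := by
            rw [zpow_add, zpow_mul f n, zpow_mul f (orderOf f), zpow_natCast f (orderOf f), pow_orderOf_eq_one,
              one_zpow, mul_one]
    rw [this]
    exact Function.IsFixedPt.perm_zpow (e := f ^ n) hnt _
  -- If 3 divided m, then `f ^ m` would also fix `a`, `b`, `c` and be trivial, although m is smaller
  -- than the order.
  have hnd : ¬ 3 ∣ m := by
    rintro ⟨q, hq⟩
    have h3f : ∀ x ∈ ({a, b, c} : Set T), (f ^ 3) x = x := by
      rintro x (rfl | rfl | rfl) <;> simp [pow_succ, hab, hbc, hca]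
    have : f ^ m = 1 := by
      ext t
      by_cases ht : t ∈ ({a, b, c} : Set T)
      · rw [hq, pow_mul]
        have := Function.IsFixedPt.perm_zpow (e := f ^ 3) (h3f t ht) q
        rw [zpow_natCast] at this
        exact this
      · simp only [Set.mem_insert_iff, Set.mem_singleton_iff, not_or] at ht
        exact hfix t ht.1 ht.2.1 ht.2.2
    have := Nat.le_of_dvd (by omega) (orderOf_dvd_of_pow_eq_one this)
    omega
  exact isThreeCycle_of_fixes_compl h1 h2 h3
    (pow_apply_ne_of_three_cycle hab hbc hca h1 h2 hnd)
    (pow_apply_ne_of_three_cycle hbc hca hab h3 h1.symm hnd)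
    (pow_apply_ne_of_three_cycle hca hab hbc h2.symm h3.symm hnd) hfix

end ThreeCycles

/-! ### The half turn exchanging the two rotations. -/

section HalfTurn

/-- The half turn of the rectangle. -/
def halfTurn (k : ℕ) : Equiv.Perm (Tile k) := Equiv.prodCongr Fin.revPerm Fin.revPerm

lemma halfTurn_moves {k : ℕ} (i j : ℤ) : Moves (halfTurn k) i j (k - 1 - i) (k - j) := by
  rintro ⟨⟨a, ha⟩, ⟨b, hb⟩⟩ ⟨h1, h2⟩
  simp only at h1 h2
  simp only [AtPos, halfTurn, Equiv.prodCongr_apply, Prod.map, Fin.revPerm_apply, Fin.val_rev]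
  omega

lemma halfTurn_mul_self (k : ℕ) : halfTurn k * halfTurn k = 1 := by
  ext ⟨a, b⟩ <;> simp [halfTurn]

lemma halfTurn_mul_sigmaL (k : ℕ) : halfTurn k * sigmaL k = sigmaR k * halfTurn k := by
  ext1 t
  have ht : AtPos t t.1 t.2 := ⟨rfl, rfl⟩
  have := ht.bounds
  by_cases h : ((t.2 : ℕ) : ℤ) = k
  · exact ((Moves.mul (sigmaL_moves (Or.inr ⟨h, rfl, rfl⟩)) (halfTurn_moves _ _)) t ht).unique
      ((Moves.mul (halfTurn_moves _ _) (sigmaR_moves (by omega))) t ht)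
  · exact ((Moves.mul (sigmaL_moves (Or.inl ⟨by omega, rfl, rfl⟩)) (halfTurn_moves _ _)) t ht).unique
      ((Moves.mul (halfTurn_moves _ _) (sigmaR_moves (by omega))) t ht)

lemma conj_halfTurn_sigmaL (k : ℕ) : MulAut.conj (halfTurn k) (sigmaL k) = sigmaR k := by
  rw [MulAut.conj_apply, halfTurn_mul_sigmaL, mul_inv_cancel_right]

lemma conj_halfTurn_sigmaR (k : ℕ) : MulAut.conj (halfTurn k) (sigmaR k) = sigmaL k := by
  have h : (halfTurn k)⁻¹ = halfTurn k := inv_eq_of_mul_eq_one_right (halfTurn_mul_self k)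
  rw [MulAut.conj_apply, mul_inv_eq_iff_eq_mul]
  calc halfTurn k * sigmaR k = halfTurn k * (sigmaR k * halfTurn k) * halfTurn k := by
        rw [mul_assoc, mul_assoc, halfTurn_mul_self, mul_one]
    _ = sigmaL k * halfTurn k := by
        rw [← halfTurn_mul_sigmaL, ← mul_assoc, halfTurn_mul_self, one_mul]

lemma map_oddWord {G H : Type*} [Group G] [Group H] (φ : G →* H) (k : ℕ) (l r : G) :
    φ (oddWord k l r) = oddWord k (φ l) (φ r) := by
  simp [oddWord]

lemma oddWord_swap (k : ℕ) :
    oddWord k (sigmaR k) (sigmaL k) = MulAut.conj (halfTurn k) (oddWord k (sigmaL k) (sigmaR k)) := by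
  have := map_oddWord (MulAut.conj (halfTurn k)).toMonoidHom k (sigmaL k) (sigmaR k)
  simp only [MulEquiv.toMonoidHom_eq_coe, MonoidHom.coe_coe, conj_halfTurn_sigmaL,
    conj_halfTurn_sigmaR] at this
  exact this.symm

lemma oddWord_eq_flowWord (k : ℕ) : oddWord k (sigmaL k) (sigmaR k) = flowWord k (alphaExp k) := rfl

end HalfTurn

/-! ### Orbits of the odd word with steps counted modulo 3. -/

/-- `Conn k α c i j i' j'`: some power of `flowWord k α` moves the tile at `(i, j)` to `(i', j')`,
with exponent congruent to `c` modulo `3`. -/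
def Conn (k α : ℕ) (c : ZMod 3) (i j i' j' : ℤ) : Prop :=
  0 ≤ i ∧ i < k ∧ 0 ≤ j ∧ j ≤ k ∧
    ∃ n : ℤ, (n : ZMod 3) = c ∧ Moves (flowWord k α ^ n) i j i' j'

section Conn

variable {k α : ℕ} {c d : ZMod 3} {i j i' j' i'' j'' : ℤ}

lemma Conn.trans (h : Conn k α c i j i' j') (h' : Conn k α d i' j' i'' j'') :
    Conn k α (c + d) i j i'' j'' := by
  obtain ⟨h1, h2, h3, h4, n, rfl, hn⟩ := h
  obtain ⟨-, -, -, -, m, rfl, hm⟩ := h'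
  refine ⟨h1, h2, h3, h4, n + m, by push_cast; rfl, ?_⟩
  rw [add_comm, zpow_add]
  exact hn.mul hm

lemma Conn.symm (h : Conn k α c i j i' j') : Conn k α (-c) i' j' i j := by
  obtain ⟨h1, h2, h3, h4, n, rfl, hn⟩ := h
  obtain ⟨t, ht⟩ := exists_atPos h1 h2 h3 h4
  obtain ⟨h5, h6, h7, h8⟩ := (hn t ht).bounds
  refine ⟨h5, h6, h7, h8, -n, by push_cast; rfl, ?_⟩
  rw [zpow_neg]
  exact hn.inv h1 h2 h3 h4

lemma Conn.cast {e : ZMod 3} {a b : ℤ} (h : Conn k α c i j i' j') (hc : c = e) (ha : i' = a)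
    (hb : j' = b) : Conn k α e i j a b := by
  subst hc ha hb; exact h

lemma Conn.refl (h1 : 0 ≤ i) (h2 : i < k) (h3 : 0 ≤ j) (h4 : j ≤ k) : Conn k α 0 i j i j :=
  ⟨h1, h2, h3, h4, 0, by simp, by simpa using Moves.one⟩

lemma Conn.of_step (hk : Odd k) (hk2 : 2 ≤ k) (hα : α ≤ k)
    (h1 : 0 ≤ i) (h2 : i < k) (h3 : 0 ≤ j) (h4 : j ≤ k) (h : StepRel k α i j i' j') :
    Conn k α 1 i j i' j' :=
  ⟨h1, h2, h3, h4, 1, by simp, by simpa using flowWord_moves hk hk2 hα h⟩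

lemma Conn.bounds (h : Conn k α c i j i' j') : 0 ≤ i' ∧ i' < k ∧ 0 ≤ j' ∧ j' ≤ k := by
  have := h.symm
  exact ⟨this.1, this.2.1, this.2.2.1, this.2.2.2.1⟩

/-- The cycle of the tile at `(i, j)` has length prime to `3`. -/
def Good (k α : ℕ) (i j : ℤ) : Prop := ∃ c : ZMod 3, c ≠ 0 ∧ Conn k α c i j i j

lemma Good.of_conn (h : Conn k α c i j i' j') (hg : Good k α i' j') : Good k α i j := by
  obtain ⟨d, hd, h'⟩ := hg
  exact ⟨d, hd, ((h.trans h').trans h.symm).cast (by ring) rfl rfl⟩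

/-- The three tiles that are permuted cyclically. -/
def Special (k α : ℕ) (i j : ℤ) : Prop :=
  (i = 0 ∧ j = α - 2) ∨ (i = α ∧ j = k - 1) ∨ (i = α - 2 ∧ j = k - 1)

/-- All cycles but one have length prime to `3`. -/
def AllGood (k α : ℕ) : Prop :=
  ∀ i j : ℤ, 0 ≤ i → i < k → 0 ≤ j → j ≤ k → Special k α i j ∨ Good k α i j

lemma special_moves (hk : Odd k) (hα : 2 ≤ α) (hαk : α + 2 ≤ k) :
    Moves (flowWord k α) 0 (α - 2) α (k - 1) ∧
    Moves (flowWord k α) α (k - 1) (α - 2) (k - 1) ∧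
    Moves (flowWord k α) (α - 2) (k - 1) 0 (α - 2) := by
  refine ⟨flowWord_moves hk (by omega) (by omega) (Or.inl ⟨by omega, ?_⟩),
    flowWord_moves hk (by omega) (by omega) (Or.inr (Or.inr (Or.inl ⟨rfl, ?_⟩))),
    flowWord_moves hk (by omega) (by omega) (Or.inr (Or.inr (Or.inl ⟨rfl, ?_⟩)))⟩ <;>
    unfold DiagRel <;> omega

/-- The colour is the parity of α: the three tiles are (0, α-2), (α, k-1), (α-2, k-1), and k-1 is
even. -/
lemma three_cycle_of_allGood (hk : Odd k) (hα : 2 ≤ α) (hαk : α + 2 ≤ k) (h : AllGood k α) :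
    3 ∣ orderOf (flowWord k α) ∧
    (flowWord k α ^ (orderOf (flowWord k α) / 3)).IsThreeCycle ∧
    ((flowWord k α ^ (orderOf (flowWord k α) / 3)).support : Set (Tile k)) ⊆
      colourClass k (α : ZMod 2) := by
  obtain ⟨a, ha⟩ := exists_atPos (k := k) (i := 0) (j := α - 2)
    (by omega) (by omega) (by omega) (by omega)
  obtain ⟨b, hb⟩ := exists_atPos (k := k) (i := α) (j := k - 1)
    (by omega) (by omega) (by omega) (by omega)
  obtain ⟨c, hc⟩ := exists_atPos (k := k) (i := α - 2) (j := k - 1)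
    (by omega) (by omega) (by omega) (by omega)
  obtain ⟨m1, m2, m3⟩ := special_moves hk hα hαk
  have hne : a ≠ b ∧ a ≠ c ∧ b ≠ c := by
    refine ⟨?_, ?_, ?_⟩ <;> rintro rfl
    · have := ha.1.symm.trans hb.1; omega
    · have := ha.2.symm.trans hc.2; omega
    · have := hb.1.symm.trans hc.1; omega
  obtain ⟨h1, h2, h3⟩ := pow_orderOf_div_three ((m1 a ha).unique hb) ((m2 b hb).unique hc)
    ((m3 c hc).unique ha) hne.1 hne.2.1 hne.2.2 (by
      intro t hta htb htc
      have ht : AtPos t t.1 t.2 := ⟨rfl, rfl⟩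
      obtain ⟨b1, b2, b3, b4⟩ := ht.bounds
      rcases h _ _ b1 b2 b3 b4 with hs | ⟨d, hd, -, -, -, -, n, rfl, hn⟩
      · rcases hs with hs | hs | hs
        · exact absurd (AtPos.unique (hs.1 ▸ hs.2 ▸ ht) ha) hta
        · exact absurd (AtPos.unique (hs.1 ▸ hs.2 ▸ ht) hb) htb
        · exact absurd (AtPos.unique (hs.1 ▸ hs.2 ▸ ht) hc) htc
      · refine ⟨n, fun hdvd => hd ?_, hn.apply_eq ht⟩
        exact (ZMod.intCast_zmod_eq_zero_iff_dvd n 3).2 hdvd)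
  refine ⟨h1, h2, ?_⟩
  rw [h3]
  obtain ⟨r, hr⟩ := hk
  intro t ht
  simp only [Finset.coe_insert, Finset.coe_singleton, Set.mem_insert_iff,
    Set.mem_singleton_iff] at ht
  simp only [colourClass, Set.mem_ofPred_eq, ZMod.natCast_eq_natCast_iff, Nat.ModEq]
  rcases ht with rfl | rfl | rfl
  · obtain ⟨h5, h6⟩ := ha; omega
  · obtain ⟨h5, h6⟩ := hb; omega
  · obtain ⟨h5, h6⟩ := hc; omega

/-- The half turn replaces i + j by 2k - 1 - (i + j), which has the other parity. -/
lemma colourClass_halfTurn {t : Tile k} {e : ZMod 2} (ht : t ∈ colourClass k e) :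
    halfTurn k t ∈ colourClass k (e + 1) := by
  have h1 : AtPos t t.1 t.2 := ⟨rfl, rfl⟩
  obtain ⟨h2, h3⟩ := halfTurn_moves _ _ t h1
  obtain ⟨m, rfl⟩ : ∃ m : ℕ, e = (m : ZMod 2) := ⟨e.val, by simp⟩
  have e1 : (m : ZMod 2) + 1 = ((m + 1 : ℕ) : ZMod 2) := by push_cast; rfl
  rw [e1]
  simp only [colourClass, Set.mem_ofPred_eq, ZMod.natCast_eq_natCast_iff, Nat.ModEq] at ht ⊢
  have := h1.bounds
  omega

/-- The statement about odd `k`, given the cycle lengths. -/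
lemma odd_case_of_allGood (hk : Odd k) (hα : 2 ≤ alphaExp k) (hαk : alphaExp k + 2 ≤ k)
    (h : AllGood k (alphaExp k)) :
    3 ∣ orderOf (oddWord k (sigmaL k) (sigmaR k)) ∧
    3 ∣ orderOf (oddWord k (sigmaR k) (sigmaL k)) ∧
    ((oddWord k (sigmaL k) (sigmaR k)) ^
      (orderOf (oddWord k (sigmaL k) (sigmaR k)) / 3)).IsThreeCycle ∧
    ((oddWord k (sigmaR k) (sigmaL k)) ^
      (orderOf (oddWord k (sigmaR k) (sigmaL k)) / 3)).IsThreeCycle ∧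
    ∃ c : ZMod 2,
      (((oddWord k (sigmaL k) (sigmaR k)) ^
        (orderOf (oddWord k (sigmaL k) (sigmaR k)) / 3)).support : Set (Tile k))
          ⊆ colourClass k c ∧
      (((oddWord k (sigmaR k) (sigmaL k)) ^
        (orderOf (oddWord k (sigmaR k) (sigmaL k)) / 3)).support : Set (Tile k))
          ⊆ colourClass k (c + 1) := by
  obtain ⟨h1, h2, h3⟩ := three_cycle_of_allGood hk hα hαk h
  rw [oddWord_swap, oddWord_eq_flowWord, ← map_pow,
    MulEquiv.orderOf_eq (MulAut.conj (halfTurn k)) (flowWord k (alphaExp k))]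
  refine ⟨h1, h1, h2, ?_, _, h3, ?_⟩
  · rw [← card_support_eq_three_iff, MulAut.conj_apply, Equiv.Perm.card_support_conj]
    exact h2.card_support
  · rw [MulAut.conj_apply, Equiv.Perm.support_conj]
    intro t ht
    simp only [Finset.coe_map, Set.mem_image] at ht
    obtain ⟨s, hs, rfl⟩ := ht
    exact colourClass_halfTurn (h3 hs)

end Conn

/-! ### Descent through the columns α, …, k-3. -/

section Walk

variable {k α : ℕ} {a c e : ℤ}

/-- Walking down the columns `c` and `k - 3 + α - c` alternately. -/
lemma conn_walk (hk : Odd k) (hk2 : 2 ≤ k) (hα : α ≤ k) (ha : 0 ≤ a) (hc : α ≤ c)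
    (hc' : c ≤ k - 3) (n : ℕ) (hn : a + α * n ≤ k - 1) :
    Conn k α n a c (a + α * n) (if Even n then c else k - 3 + α - c) := by
  induction n with
  | zero => simpa using Conn.refl (k := k) (α := α) ha (by simp at hn; omega) (by omega) (by omega)
  | succ n ih =>
    have hrow : a + α * ((n + 1 : ℕ) : ℤ) = (a + α * n) + α := by push_cast; ring
    have hnn : (0 : ℤ) ≤ α * n := by positivity
    rw [hrow] at hn ⊢
    have ih := ih (by omega)
    generalize (α : ℤ) * n = s at *
    refine (ih.trans (Conn.of_step hk hk2 hα (by omega) (by omega) ?_ ?_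
      (i' := a + s + α) (j' := if Even n then k - 3 + α - c else c) ?_)).cast ?_ rfl ?_
    · split_ifs <;> omega
    · split_ifs <;> omega
    · split_ifs <;> refine Or.inl ⟨by omega, ?_⟩ <;> unfold DiagRel <;> omega
    · push_cast; rfl
    · by_cases h : Even n <;> simp [Nat.even_add_one, h]

/-- From the top of a column down and round to the left border. -/
lemma conn_pass (hk : Odd k) (hk2 : 2 ≤ k) (hα : α ≤ k) (ha : 0 ≤ a) (hc : α ≤ c)
    (hc' : c ≤ k - 3) (T : ℕ) (hT : a + α * (T + 1) = k + e) (he : 0 ≤ e) (he' : e < α) :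
    Conn k α (T + 1) a c ((if Even T then k - 3 + α - c else c) - 1) e := by
  have hrow : a + α * T = k + e - α := by linear_combination hT
  have h1 := conn_walk hk hk2 hα ha hc hc' T (by omega)
  rw [hrow] at h1
  refine h1.trans (Conn.of_step hk hk2 hα (by omega) (by omega) ?_ ?_ ?_)
  · split_ifs <;> omega
  · split_ifs <;> omega
  · split_ifs <;> refine Or.inl ⟨by omega, Or.inr (Or.inl ?_)⟩ <;> omega

/-- Every tile in the columns `α, …, k - 3` lies below the top of a column. -/
lemma exists_conn_top (hk : Odd k) (hk2 : 2 ≤ k) (hα : α ≤ k) (hα0 : 0 < α) {i : ℤ} (hi : 0 ≤ i)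
    (hi' : i < k) (hc : α ≤ c) (hc' : c ≤ k - 3) :
    ∃ (d : ZMod 3) (a x : ℤ), 0 ≤ a ∧ a < α ∧ (x = c ∨ x = k - 3 + α - c) ∧ Conn k α d i c a x := by
  have hα' : (0 : ℤ) < α := by exact_mod_cast hα0
  have hm0 := Int.emod_nonneg i hα'.ne'
  have hm1 := Int.emod_lt_of_pos i hα'
  have hdm := Int.emod_add_mul_ediv i α
  obtain ⟨n, hn⟩ := Int.eq_ofNat_of_zero_le (Int.ediv_nonneg hi hα'.le)
  rw [hn] at hdm
  rcases Nat.even_or_odd n with h | h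
  · have h1 := conn_walk hk hk2 hα hm0 hc hc' n (by omega)
    rw [if_pos h, hdm] at h1
    exact ⟨_, _, _, hm0, hm1, Or.inl rfl, h1.symm⟩
  · have h1 := conn_walk hk hk2 hα hm0 (c := k - 3 + α - c) (by omega) (by omega) n (by omega)
    rw [if_neg (by simpa using h), hdm] at h1
    exact ⟨_, _, _, hm0, hm1, Or.inr rfl, h1.symm.cast rfl rfl rfl |> fun h => by
      simpa using h⟩

end Walk

/-! ### Return from the left and right borders to the top rows. -/

section Border

variable {k α : ℕ} {i j e : ℤ}

/-- The mirror column k-3-e is at least k+1-α, so the diagonal flow crosses the right border at once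
and re-enters at the top. -/
lemma conn_left_low (hk : Odd k) (hα : α ≤ k) (hi : 0 ≤ i) (he : 0 ≤ e)
    (he' : e ≤ α - 4)
    (hie : i + e + 3 ≤ k - 1) (hiα : i + α ≤ k) : Conn k α 1 i e (α - 4 - e) (i + α) := by
  refine Conn.of_step hk (by omega) hα hi (by omega) he (by omega) (Or.inl ⟨by omega, ?_⟩)
  by_cases h : k - 3 - e ≤ i
  · exfalso; omega
  · exact Or.inr (Or.inr (Or.inr (Or.inl (by omega))))

/-- The three values of `e` are the last three columns. Their rows are reflected before the flow
carries them across the right border. -/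
lemma conn_right (hk : Odd k) (hk2 : 2 ≤ k) (hα : α ≤ k) (hα2 : 2 ≤ α) (hi : α ≤ i) (hi' : i < k)
    (he : 0 ≤ e) (he1 : α - 3 ≤ e) (he' : e < α) :
    Conn k α 1 i (k - 3 + α - e) e (k - 1 + α - i) := by
  refine Conn.of_step hk (by omega) hα (by omega) (by omega) (by omega) (by omega) ?_
  obtain h | h | h : e = α - 1 ∨ e = α - 2 ∨ e = α - 3 := by omega
  · exact Or.inr (Or.inl ⟨by omega, Or.inr (Or.inr (Or.inr (Or.inl (by omega))))⟩)
  · exact Or.inr (Or.inr (Or.inl ⟨by omega, Or.inr (Or.inr (Or.inr (Or.inl (by omega))))⟩))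
  · exact Or.inr (Or.inr (Or.inr ⟨by omega, Or.inr (Or.inr (Or.inr (Or.inl (by omega))))⟩))

/-- Here the mirror column is too far left to cross the border in one step; the tile lands in the
last three columns and `conn_right` completes the return. -/
lemma conn_left_high (hk : Odd k) (hαk : α + 2 ≤ k) (hα2 : 2 ≤ α) (hi : 0 ≤ i) (hi' : i + α < k)
    (he : 0 ≤ e) (he1 : α - 3 ≤ e) (he' : e < α) :
    Conn k α 2 i e e (k - 1 - i) := by
  refine (Conn.trans (i' := i + α) (j' := k - 3 + α - e) (c := 1) ?_
    (conn_right hk (by omega) (by omega) hα2 (by omega) hi' he he1 he')).cast rfl rfl (by ring)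
  refine Conn.of_step hk (by omega) (by omega) (by omega) (by omega) (by omega) (by omega)
    (Or.inl ⟨by omega, ?_⟩)
  by_cases h : k - 3 - e ≤ i
  · exact Or.inl (by omega)
  · exact Or.inr (Or.inr (Or.inl (by omega)))

end Border

/-! ### Evaluation of orbits near the border, with `k` as an indeterminate -/

/-- The pair `(q, p)` stands for the affine function `q * k + p` of `k`. -/
abbrev Aff : Type := ℤ × ℤ

namespace Aff

/-- The value of an affine function. -/
def ev (k : ℕ) (x : Aff) : ℤ := x.1 * k + x.2

/-- The sum of two affine functions. -/
def plus (x y : Aff) : Aff := (x.1 + y.1, x.2 + y.2)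

/-- The difference of two affine functions. -/
def minus (x y : Aff) : Aff := (x.1 - y.1, x.2 - y.2)

lemma ev_plus (k : ℕ) (x y : Aff) : ev k (plus x y) = ev k x + ev k y := by
  simp only [ev, plus]; ring

lemma ev_minus (k : ℕ) (x y : Aff) : ev k (minus x y) = ev k x - ev k y := by
  simp only [ev, minus]; ring

/-- A sufficient condition for `x ≤ y` at all `k ≥ K`. -/
def cle (K : ℕ) (x y : Aff) : Bool := decide (x.1 ≤ y.1) && decide (x.1 * K + x.2 ≤ y.1 * K + y.2)

lemma ev_le_of_cle {K k : ℕ} (hK : K ≤ k) {x y : Aff} (h : cle K x y = true) :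
    ev k x ≤ ev k y := by
  simp only [cle, Bool.and_eq_true, decide_eq_true_eq] at h
  have hK' : (K : ℤ) ≤ k := by exact_mod_cast hK
  simp only [ev]
  nlinarith [mul_nonneg (sub_nonneg.2 h.1) (sub_nonneg.2 hK')]

end Aff

open Aff in
/-- The diagonal flow on affine coordinates. -/
def diagEval (K α : ℕ) (i j : Aff) : Option (Aff × Aff) :=
  let i' := plus i (0, α)
  let j' := plus j (0, α)
  if cle K j i then
    if cle K i' (1, -1) then some (i', j')
    else if cle K (1, 0) i' && cle K j' (1, 0) then some (plus j' (0, -1), minus i' (1, 0))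
    else if cle K (1, 1) i' && cle K (1, 1) j' then some (minus i' (1, 1), minus j' (1, 1))
    else none
  else if cle K (plus i (0, 1)) j then
    if cle K j' (1, 0) then some (i', j')
    else if cle K (1, 1) j' && cle K i' (1, 0) then some (minus j' (1, 1), i')
    else if cle K (1, 1) i' && cle K (1, 1) j' then some (minus i' (1, 1), minus j' (1, 1))
    else none
  else none

open Aff in
lemma diagRel_of_diagEval {K k α : ℕ} (hK : K ≤ k) {i j i' j' : Aff}
    (h : diagEval K α i j = some (i', j')) :
    DiagRel k α (ev k i) (ev k j) (ev k i') (ev k j') := by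
  have e1 : ev k (0, α) = α := by simp [ev]
  have e2 : ev k (1, -1) = k - 1 := by simp [ev]; ring
  have e3 : ev k (1, 0) = k := by simp [ev]
  have e4 : ev k (1, 1) = k + 1 := by simp [ev]
  have e5 : ev k (0, 1) = 1 := by simp [ev]
  have e6 : ev k (0, -1) = -1 := by simp [ev]
  unfold diagEval at h
  simp only [Bool.and_eq_true] at h
  split_ifs at h with h1 h2 h3 h4 h5 h6 h7 h8 <;>
    simp only [Option.some.injEq, Prod.mk.injEq] at h <;> obtain ⟨rfl, rfl⟩ := h <;>
    simp only [ev_plus, ev_minus, e1, e3, e4, e6]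
  · have a1 := ev_le_of_cle hK h1
    have a2 := ev_le_of_cle hK h2
    simp only [ev_plus, e1, e2] at a2
    exact Or.inl (by omega)
  · have a1 := ev_le_of_cle hK h1
    have a2 := ev_le_of_cle hK h3.1
    have a3 := ev_le_of_cle hK h3.2
    simp only [ev_plus, e1, e3] at a2 a3
    exact Or.inr (Or.inl (by omega))
  · have a2 := ev_le_of_cle hK h4.1
    have a3 := ev_le_of_cle hK h4.2
    simp only [ev_plus, e1, e4] at a2 a3
    exact Or.inr (Or.inr (Or.inr (Or.inr (by omega))))
  · have a1 := ev_le_of_cle hK h5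
    have a2 := ev_le_of_cle hK h6
    simp only [ev_plus, e1, e3, e5] at a1 a2
    exact Or.inr (Or.inr (Or.inl (by omega)))
  · have a1 := ev_le_of_cle hK h5
    have a2 := ev_le_of_cle hK h7.1
    have a3 := ev_le_of_cle hK h7.2
    simp only [ev_plus, e1, e3, e4, e5] at a1 a2 a3
    exact Or.inr (Or.inr (Or.inr (Or.inl (by omega))))
  · have a2 := ev_le_of_cle hK h8.1
    have a3 := ev_le_of_cle hK h8.2
    simp only [ev_plus, e1, e4] at a2 a3
    exact Or.inr (Or.inr (Or.inr (Or.inr (by omega))))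

open Aff in
/-- One application of `flowWord` on affine coordinates. -/
def stepEval (K α : ℕ) (i j : Aff) : Option (Aff × Aff) :=
  if cle K j (1, -3) then diagEval K α i (minus (1, -3) j)
  else if j = (1, -2) then diagEval K α (minus (1, -1) i) (1, 0)
  else if j = (1, -1) then diagEval K α (minus (1, -1) i) (1, -1)
  else if j = (1, 0) then diagEval K α (minus (1, -1) i) (1, -2)
  else none

open Aff in
lemma stepRel_of_stepEval {K k α : ℕ} (hK : K ≤ k) {i j i' j' : Aff}
    (h : stepEval K α i j = some (i', j')) :
    StepRel k α (ev k i) (ev k j) (ev k i') (ev k j') := by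
  have e2 : ev k (1, -1) = k - 1 := by simp [ev]; ring
  have e3 : ev k (1, 0) = k := by simp [ev]
  have e4 : ev k (1, -2) = k - 2 := by simp [ev]; ring
  have e5 : ev k (1, -3) = k - 3 := by simp [ev]; ring
  unfold stepEval at h
  split_ifs at h with h1 h2 h3 h4
  · have a1 := ev_le_of_cle hK h1
    have := diagRel_of_diagEval hK h
    rw [ev_minus, e5] at this
    exact Or.inl ⟨by omega, this⟩
  · have := diagRel_of_diagEval hK h
    rw [ev_minus, e2, e3] at this
    exact Or.inr (Or.inl ⟨by rw [h2, e4], this⟩)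
  · have := diagRel_of_diagEval hK h
    rw [ev_minus, e2] at this
    exact Or.inr (Or.inr (Or.inl ⟨by rw [h3, e2], this⟩))
  · have := diagRel_of_diagEval hK h
    rw [ev_minus, e2, e4] at this
    exact Or.inr (Or.inr (Or.inr ⟨by rw [h4, e3], this⟩))

open Aff in
/-- One application of `flowWord`, or a whole run down to the left border for a tile at the top of
a column; here `k = α q + r` with `q ≡ ρ` modulo `6`. The last component counts the
applications of `flowWord` modulo `3`. -/
def nextEval (K α r ρ : ℕ) (i j : Aff) : Option (Aff × Aff × ℕ) :=
  if i.1 = 0 ∧ 0 ≤ i.2 ∧ i.2 < α ∧ cle K (0, α) j = true ∧ cle K j (1, -3) = true then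
    if r ≤ i.2 then
      some (plus (if ρ % 2 = 0 then j else minus (1, α - 3) j) (0, -1), (0, i.2 - r), ρ % 3)
    else
      some (plus (if ρ % 2 = 1 then j else minus (1, α - 3) j) (0, -1), (0, i.2 + α - r),
        (ρ + 1) % 3)
  else
    match stepEval K α i j with
    | some (i', j') => some (i', j', 1)
    | none => none

/-- The standing assumptions for the evaluation of orbits. -/
structure EvalData (K α r ρ k : ℕ) : Prop where
  odd : Odd k
  two_le : 2 ≤ k
  lt : α ≤ k
  le : K ≤ k
  rlt : r < α
  rho : ∃ q : ℕ, k = α * q + r ∧ q % 6 = ρ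
  pos : α < k

section Eval

variable {K α r ρ k : ℕ}

open Aff in
lemma conn_of_nextEval (D : EvalData K α r ρ k) {i j i' j' : Aff} {c : ℕ}
    (h1 : 0 ≤ ev k i) (h2 : ev k i < k) (h3 : 0 ≤ ev k j) (h4 : ev k j ≤ k)
    (h : nextEval K α r ρ i j = some (i', j', c)) :
    Conn k α c (ev k i) (ev k j) (ev k i') (ev k j') := by
  obtain ⟨q, hq, hρ⟩ := D.rho
  have hr := D.rlt
  have hpos := D.pos
  have hqz : (k : ℤ) = α * q + r := by exact_mod_cast hq
  have hq1 : q ≠ 0 := by rintro rfl; simp at hq; omega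
  -- Since k > α > r, the quotient q is nonzero and q - 1 is a genuine difference.
  have hsub : ((q - 1 : ℕ) : ℤ) = q - 1 := by omega
  have hcast : ∀ m : ℕ, ((m % 3 : ℕ) : ZMod 3) = (m : ZMod 3) := fun m =>
    ZMod.natCast_mod m 3
  have hq3 : ((ρ : ℕ) : ZMod 3) = (q : ZMod 3) := by
    rw [ZMod.natCast_eq_natCast_iff, Nat.ModEq]; omega
  unfold nextEval at h
  by_cases g1 : i.1 = 0 ∧ 0 ≤ i.2 ∧ i.2 < α ∧ cle K (0, α) j = true ∧ cle K j (1, -3) = true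
  · rw [if_pos g1] at h
    obtain ⟨b1, b2, b3, b4, b5⟩ := g1
    have b4 := ev_le_of_cle D.le b4
    have b5 := ev_le_of_cle D.le b5
    have ei : ev k i = i.2 := by simp [ev, b1]
    have e5 : ev k (1, -3) = k - 3 := by simp [ev]; ring
    have e0 : ev k (0, α) = α := by simp [ev]
    rw [e5] at b5
    rw [e0] at b4
    by_cases g2 : r ≤ i.2
    · rw [if_pos g2] at h
      simp only [Option.some.injEq, Prod.mk.injEq] at h
      obtain ⟨rfl, rfl, rfl⟩ := h
      -- For a ≥ r the q-th step leaves the board, as a + α q = k + (a - r); for a < r one more is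
      -- needed. The parity of q selects the column and q modulo 3 the step count, which is why q
      -- modulo 6 suffices.
      have := conn_pass D.odd D.two_le D.lt b2 b4 b5 (q - 1) (e := i.2 - r)
        (by rw [hsub, hqz]; ring) (by omega) (by omega)
      rw [ei]
      refine this.cast ?_ ?_ ?_
      · rw [hcast, hq3, ← Nat.cast_add_one]; congr 1; omega
      · rw [ev_plus]
        have : Even (q - 1) ↔ ¬ (ρ % 2 = 0) := by rw [Nat.even_iff]; omega
        by_cases hh : ρ % 2 = 0 <;> simp [this, hh, ev, minus] <;> ring
      · simp [ev]
    · rw [if_neg g2] at h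
      simp only [Option.some.injEq, Prod.mk.injEq] at h
      obtain ⟨rfl, rfl, rfl⟩ := h
      have := conn_pass D.odd D.two_le D.lt b2 b4 b5 q (e := i.2 + α - r)
        (by rw [hqz]; ring) (by omega) (by omega)
      rw [ei]
      refine this.cast ?_ ?_ ?_
      · rw [hcast, Nat.cast_add, hq3, Nat.cast_one]
      · rw [ev_plus]
        have : Even q ↔ ¬ (ρ % 2 = 1) := by rw [Nat.even_iff]; omega
        by_cases hh : ρ % 2 = 1 <;> simp [this, hh, ev, minus] <;> ring
      · simp [ev]
  · rw [if_neg g1] at h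
    split at h
    · rename_i i1 j1 heq
      simp only [Option.some.injEq, Prod.mk.injEq] at h
      obtain ⟨rfl, rfl, rfl⟩ := h
      simpa using Conn.of_step D.odd D.two_le D.lt h1 h2 h3 h4 (stepRel_of_stepEval D.le heq)
    · simp at h

/-- Follow the orbit until a state satisfies `halt`. -/
def runEval (K α r ρ : ℕ) (halt : Aff → Aff → Bool) :
    ℕ → Aff → Aff → ℕ → Option (Aff × Aff × ℕ)
  | 0, _, _, _ => none
  | n + 1, i, j, c =>
    match nextEval K α r ρ i j with
    | none => none
    | some (i', j', d) =>
      if halt i' j' then some (i', j', (c + d) % 3) else runEval K α r ρ halt n i' j' ((c + d) % 3)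

open Aff in
lemma conn_of_runEval (D : EvalData K α r ρ k) {halt : Aff → Aff → Bool} {i₀ j₀ : ℤ} (n : ℕ)
    {i j i' j' : Aff} {c d : ℕ} (hc : Conn k α c i₀ j₀ (ev k i) (ev k j))
    (h : runEval K α r ρ halt n i j c = some (i', j', d)) :
    Conn k α d i₀ j₀ (ev k i') (ev k j') ∧ halt i' j' = true := by
  induction n generalizing i j c with
  | zero => simp [runEval] at h
  | succ n ih =>
    unfold runEval at h
    split at h
    · simp at h
    · rename_i i1 j1 d1 heq
      obtain ⟨h1, h2, h3, h4⟩ := hc.bounds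
      have hc' : Conn k α ((c + d1) % 3 : ℕ) i₀ j₀ (ev k i1) (ev k j1) :=
        (hc.trans (conn_of_nextEval D h1 h2 h3 h4 heq)).cast
          (by rw [ZMod.natCast_mod]; push_cast; rfl) rfl rfl
      split_ifs at h with hs
      · simp only [Option.some.injEq, Prod.mk.injEq] at h
        obtain ⟨rfl, rfl, rfl⟩ := h
        exact ⟨hc', hs⟩
      · exact ih hc' h

/-- The three exceptional tiles on affine coordinates. -/
def specialEval (α : ℕ) (i j : Aff) : Bool :=
  (i = (0, 0) ∧ j = (0, (α : ℤ) - 2)) ∨ (i = (0, (α : ℤ)) ∧ j = (1, -1)) ∨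
    (i = (0, (α : ℤ) - 2) ∧ j = (1, -1))

/-- Check that the orbit of `(i, j)` has length prime to `3`, or reaches a state that satisfies
`known`, or that the tile is exceptional. -/
def goodEval (K α r ρ : ℕ) (known : Aff → Aff → Bool) (i j : Aff) : Bool :=
  specialEval α i j || known i j ||
    match runEval K α r ρ (fun i' j' => (i' = i ∧ j' = j) || known i' j') 100 i j 0 with
    | none => false
    | some (i', j', c) => known i' j' || c % 3 != 0

open Aff in
lemma good_of_goodEval (D : EvalData K α r ρ k) {known : Aff → Aff → Bool}
    (hknown : ∀ i j, known i j = true → Good k α (ev k i) (ev k j)) {i j : Aff}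
    (h1 : 0 ≤ ev k i) (h2 : ev k i < k) (h3 : 0 ≤ ev k j) (h4 : ev k j ≤ k)
    (h : goodEval K α r ρ known i j = true) :
    Special k α (ev k i) (ev k j) ∨ Good k α (ev k i) (ev k j) := by
  unfold goodEval at h
  simp only [Bool.or_eq_true] at h
  rcases h with (h | h) | h
  · left
    simp only [specialEval, decide_eq_true_eq] at h
    rcases h with ⟨rfl, rfl⟩ | ⟨rfl, rfl⟩ | ⟨rfl, rfl⟩ <;> simp [Special, ev] <;> omega
  · exact Or.inr (hknown _ _ h)
  · right
    split at h
    · simp at h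
    · rename_i i' j' c heq
      have h0 : Conn k α (0 : ℕ) (ev k i) (ev k j) (ev k i) (ev k j) := by
        simpa using Conn.refl h1 h2 h3 h4
      obtain ⟨hc, hs⟩ := conn_of_runEval D 100 h0 heq
      by_cases hkn : known i' j' = true
      · exact Good.of_conn hc (hknown _ _ hkn)
      · simp only [hkn, Bool.or_eq_true, decide_eq_true_eq, Bool.false_eq_true, or_false] at hs
        simp only [hkn, Bool.false_or, bne_iff_ne, ne_eq] at h
        obtain ⟨rfl, rfl⟩ := hs
        refine ⟨c, ?_, hc⟩
        rw [Ne, ZMod.natCast_eq_zero_iff]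
        omega

end Eval

/-- Check the tiles in a rectangle of `A` rows and `B` columns with upper left corner
`(i₀, j₀)`. -/
def rectEval (chk : Aff → Aff → Bool) (i₀ j₀ : Aff) (A B : ℕ) : Bool :=
  (List.range A).all fun a => (List.range B).all fun b =>
    chk (i₀.1, i₀.2 + a) (j₀.1, j₀.2 + b)

section Rect

variable {K α r ρ k : ℕ}

open Aff in
lemma chk_of_rectEval {chk : Aff → Aff → Bool} {i₀ j₀ : Aff} {A B : ℕ}
    (h : rectEval chk i₀ j₀ A B = true) {i j : ℤ} (hi : ev k i₀ ≤ i) (hi' : i < ev k i₀ + A)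
    (hj : ev k j₀ ≤ j) (hj' : j < ev k j₀ + B) :
    ∃ x y, ev k x = i ∧ ev k y = j ∧ chk x y = true := by
  obtain ⟨a, ha⟩ := Int.eq_ofNat_of_zero_le (sub_nonneg.2 hi)
  obtain ⟨b, hb⟩ := Int.eq_ofNat_of_zero_le (sub_nonneg.2 hj)
  simp only [rectEval, List.all_eq_true, List.mem_range] at h
  refine ⟨_, _, ?_, ?_, h a (by omega) b (by omega)⟩
  · simp only [ev] at *; omega
  · simp only [ev] at *; omega

open Aff in
lemma good_of_rectEval (D : EvalData K α r ρ k) {known : Aff → Aff → Bool}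
    (hknown : ∀ i j, known i j = true → Good k α (ev k i) (ev k j)) {i₀ j₀ : Aff} {A B : ℕ}
    (h : rectEval (goodEval K α r ρ known) i₀ j₀ A B = true) {i j : ℤ}
    (h1 : 0 ≤ i) (h2 : i < k) (h3 : 0 ≤ j) (h4 : j ≤ k)
    (hi : ev k i₀ ≤ i) (hi' : i < ev k i₀ + A) (hj : ev k j₀ ≤ j) (hj' : j < ev k j₀ + B) :
    Special k α i j ∨ Good k α i j := by
  obtain ⟨x, y, rfl, rfl, hxy⟩ := chk_of_rectEval h hi hi' hj hj'
  exact good_of_goodEval D hknown h1 h2 h3 h4 hxy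

end Rect

/-! ### The exponent α = 3. -/

section AlphaThree

variable {k : ℕ} {a c e : ℤ}

/-- For α = 3 every left border column satisfies e ≥ α - 3, so each return costs exactly two steps
after the descent. -/
lemma return_three (hk : Odd k) (hk5 : 5 ≤ k) (ha : 0 ≤ a) (hc : 3 ≤ c) (hc' : c ≤ k - 3) (T : ℕ)
    (hT : a + 3 * (T + 1) = k + e) (he : 0 ≤ e) (he' : e < 3) :
    Conn k 3 (T + 1 + 2) a c e (if Even T then c else k - c) := by
  have h := conn_pass (α := 3) hk (by omega) (by omega) ha (by exact_mod_cast hc) hc' T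
    (by push_cast; exact hT) he (by exact_mod_cast he')
  refine h.trans ((conn_left_high hk (by omega) (by omega) ?_ ?_ he (by omega)
    (by omega)).cast rfl rfl ?_) <;> split_ifs <;> push_cast <;> omega

/-- Write q for the integer part of k/3. If 3 divides k, the tile is back after q + 2 steps; as q is
odd, 3 divides this only for q ≡ 1 modulo 6, that is k ≡ 3 modulo 18. If k ≡ 1 or 2 modulo 3, the
three top rows are visited cyclically, with total 3q + 7 or 3q + 8, never divisible by 3. -/
lemma good_three_top (hk : Odd k) (hk5 : 5 ≤ k) (h9 : k % 18 ≠ 3) (ha : 0 ≤ a) (ha' : a < 3)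
    (hc : 3 ≤ c) (hc' : c ≤ k - 3) : Good k 3 a c := by
  have hne : ∀ m : ℕ, m % 3 ≠ 0 → (m : ZMod 3) ≠ 0 := fun m hm => by
    rw [Ne, ZMod.natCast_eq_zero_iff]; omega
  obtain ⟨q, hq⟩ : ∃ q, q = k / 3 := ⟨_, rfl⟩
  have hk2 : k % 2 = 1 := Nat.odd_iff.1 hk
  have hsub : ((q - 1 : ℕ) : ℤ) = q - 1 := by omega
  have hsub' : ((q - 1 : ℕ) : ZMod 3) = q - 1 := by
    rw [Nat.cast_sub (by omega), Nat.cast_one]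
  obtain hr | hr | hr : k % 3 = 0 ∨ k % 3 = 1 ∨ k % 3 = 2 := by omega
  · have hT := return_three hk hk5 ha hc hc' (q - 1) (e := a) (by omega) (by omega) (by omega)
    rw [if_pos (by rw [Nat.even_iff]; omega)] at hT
    refine ⟨_, ?_, hT⟩
    have := hne (q - 1 + 1 + 2) (by omega)
    push_cast at this ⊢
    exact this
  · have he : Even q := by rw [Nat.even_iff]; omega
    have ho : ¬ Even (q - 1) := by rw [Nat.even_iff]; omega
    have t0 : ∀ {x : ℤ}, 3 ≤ x → x ≤ k - 3 → Conn k 3 (q + 1 + 2) 0 x 2 x := fun h1 h2 => by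
      have := return_three hk hk5 le_rfl h1 h2 q (e := 2) (by omega) (by omega) (by omega)
      rwa [if_pos he] at this
    have t1 : ∀ {y x : ℤ}, 1 ≤ y → y ≤ 2 → 3 ≤ x → x ≤ k - 3 →
        Conn k 3 (q + 2) y x (y - 1) (k - x) := fun {y x} h1 h2 h3 h4 => by
      have := return_three hk hk5 (by omega) h3 h4 (q - 1) (a := y) (e := y - 1)
        (by omega) (by omega) (by omega)
      rw [if_neg ho] at this
      exact this.cast (by rw [hsub']; ring) rfl rfl
    have g0 : ∀ {x : ℤ}, 3 ≤ x → x ≤ k - 3 → Good k 3 0 x := fun {x} h1 h2 => by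
      refine ⟨_, ?_, ((t0 h1 h2).trans ((t1 (by omega) le_rfl h1 h2).trans
        (t1 (by omega) (by omega) (by omega) (by omega)))).cast rfl (by omega) (by omega)⟩
      have := hne (3 * q + 7) (by omega)
      push_cast at this
      intro h
      exact this (by linear_combination h)
    obtain rfl | rfl | rfl : a = 0 ∨ a = 1 ∨ a = 2 := by omega
    · exact g0 hc hc'
    · exact Good.of_conn (t1 le_rfl (by omega) hc hc') (g0 (by omega) (by omega))
    · exact Good.of_conn (t0 hc hc').symm (g0 hc hc')
  · have he : Even (q - 1) := by rw [Nat.even_iff]; omega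
    have ho : ¬ Even q := by rw [Nat.even_iff]; omega
    have t0 : ∀ {y x : ℤ}, 0 ≤ y → y ≤ 1 → 3 ≤ x → x ≤ k - 3 →
        Conn k 3 (q + 1 + 2) y x (y + 1) (k - x) := fun {y x} h1 h2 h3 h4 => by
      have := return_three hk hk5 h1 h3 h4 q (e := y + 1) (by omega) (by omega) (by omega)
      rwa [if_neg ho] at this
    have t2 : ∀ {x : ℤ}, 3 ≤ x → x ≤ k - 3 → Conn k 3 (q + 2) 2 x 0 x := fun h1 h2 => by
      have := return_three hk hk5 (a := 2) (by omega) h1 h2 (q - 1) (e := 0)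
        (by omega) (by omega) (by omega)
      rw [if_pos he] at this
      exact this.cast (by rw [hsub']; ring) rfl rfl
    have g2 : ∀ {x : ℤ}, 3 ≤ x → x ≤ k - 3 → Good k 3 2 x := fun {x} h1 h2 => by
      refine ⟨_, ?_, ((t2 h1 h2).trans ((t0 le_rfl (by omega) h1 h2).trans
        (t0 (by omega) (by omega) (by omega) (by omega)))).cast rfl (by omega) (by omega)⟩
      have := hne (3 * q + 8) (by omega)
      push_cast at this
      intro h
      exact this (by linear_combination h)
    obtain rfl | rfl | rfl : a = 0 ∨ a = 1 ∨ a = 2 := by omega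
    · exact Good.of_conn (t2 hc hc').symm (g2 hc hc')
    · exact Good.of_conn (t0 (by omega) le_rfl hc hc') (g2 (by omega) (by omega))
    · exact g2 hc hc'

lemma rects_three : ∀ r < 3, ∀ ρ < 6,
    rectEval (goodEval 7 3 r ρ fun _ _ => false) (0, 0) (0, 0) 2 3 = true ∧
    rectEval (goodEval 7 3 r ρ fun _ _ => false) (1, -3) (0, 0) 3 3 = true ∧
    rectEval (goodEval 7 3 r ρ fun _ _ => false) (0, 0) (1, -2) 5 3 = true := by
  decide +kernel

/-- The exponent 40 is 1 modulo 3, so it certifies that the other cycle lengths are prime to 3. -/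
lemma flowWord_five_pow : ∀ t : Tile 5, (t = (0, 1) ∨ t = (3, 4) ∨ t = (1, 4)) ∨
    (flowWord 5 3 ^ 40) t = t := by
  decide +kernel

lemma allGood_five : AllGood 5 3 := by
  intro i j h1 h2 h3 h4
  obtain ⟨t, ht⟩ := exists_atPos h1 h2 h3 h4
  rcases flowWord_five_pow t with h | h
  · left
    obtain ⟨ht1, ht2⟩ := ht
    rcases h with rfl | rfl | rfl <;> simp at ht1 ht2 <;> simp [Special] <;> omega
  · refine Or.inr ⟨1, by decide, h1, h2, h3, h4, 40, by decide, fun s hs => ?_⟩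
    rw [hs.unique ht]
    rw [show (40 : ℤ) = ((40 : ℕ) : ℤ) from rfl, zpow_natCast, h]
    exact ht

open Aff in
lemma allGood_three (hk : Odd k) (hk3 : 3 < k) (h9 : k % 18 ≠ 3) : AllGood k 3 := by
  have hk2 : k % 2 = 1 := Nat.odd_iff.1 hk
  obtain rfl | hk7 : k = 5 ∨ 7 ≤ k := by omega
  · exact allGood_five
  intro i j h1 h2 h3 h4
  have D : EvalData 7 3 (k % 3) (k / 3 % 6) k :=
    ⟨hk, by omega, by omega, hk7, by omega, ⟨k / 3, by omega, rfl⟩, by omega⟩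
  obtain ⟨r1, r2, r3⟩ := rects_three (k % 3) (by omega) (k / 3 % 6) (by omega)
  have hkn : ∀ i j : Aff, (fun _ _ => false : Aff → Aff → Bool) i j = true →
      Good k 3 (ev k i) (ev k j) := by simp
  by_cases hj : j < 3
  · by_cases hi : i < 2
    · exact good_of_rectEval D hkn r1 h1 h2 h3 h4 (by simp [ev]; omega) (by simp [ev]; omega)
        (by simp [ev]; omega) (by simp [ev]; omega)
    by_cases hi' : k - 3 ≤ i
    · exact good_of_rectEval D hkn r2 h1 h2 h3 h4 (by simp [ev]; omega) (by simp [ev]; omega)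
        (by simp [ev]; omega) (by simp [ev]; omega)
    right
    exact Good.of_conn (conn_left_high hk (by omega) (by omega) (by omega) (by omega) (by omega)
      (by push_cast; omega) (by omega))
      (good_three_top hk (by omega) h9 h3 hj (by omega) (by omega))
  by_cases hj' : j ≤ k - 3
  · right
    obtain ⟨d, a, x, ha, ha', hx, hc⟩ := exists_conn_top (α := 3) hk (by omega) (by omega)
      (by omega) h1 h2 (c := j) (by push_cast; omega) hj'
    push_cast at ha' hx
    exact Good.of_conn hc (good_three_top hk (by omega) h9 ha ha' (by omega) (by omega))
  · by_cases hi : i < 5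
    · exact good_of_rectEval D hkn r3 h1 h2 h3 h4 (by simp [ev]; omega) (by simp [ev]; omega)
        (by simp [ev]; omega) (by simp [ev]; omega)
    right
    have := conn_right (α := 3) (e := k - j) hk (by omega) (by omega) (by omega) (i := i)
      (by push_cast; omega) h2 (by omega) (by push_cast; omega) (by push_cast; omega)
    rw [show (k : ℤ) - 3 + (3 : ℕ) - (k - j) = j by push_cast; ring] at this
    exact Good.of_conn this
      (good_three_top hk (by omega) h9 (by omega) (by omega) (by push_cast; omega)
        (by push_cast; omega))

end AlphaThree

lemma natCast_zmod_three {q m : ℕ} (h : q % 3 = m % 3) : (q : ZMod 3) = m :=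
  (ZMod.natCast_eq_natCast_iff' q m 3).2 h

/-! ### The exponent α = 2, for k ≡ 21 modulo 36. -/

section AlphaTwo

variable {k : ℕ} {a c : ℤ}

lemma return_two_zero (hk : k % 36 = 21) (hc : 2 ≤ c) (hc' : c ≤ k - 3) :
    Conn k 2 1 0 c 1 (c + 1) := by
  have hodd : Odd k := Nat.odd_iff.2 (by omega)
  obtain ⟨q, hq⟩ : ∃ q, q = k / 2 := ⟨_, rfl⟩
  have h := conn_pass (α := 2) hodd (by omega) (by omega) (a := 0) le_rfl (by exact_mod_cast hc) hc'
    q (e := 1) (by push_cast; omega) (by omega) (by omega)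
  rw [if_pos (by rw [Nat.even_iff]; omega)] at h
  refine (h.trans (conn_left_high hodd (by omega) le_rfl (by push_cast; omega)
    (by push_cast; omega) (by omega) (by omega) (by omega))).cast ?_ rfl (by push_cast; ring)
  rw [natCast_zmod_three (q := q) (m := 1) (by omega)]
  decide

lemma return_two_one (hk : k % 36 = 21) (hc : 2 ≤ c) (hc' : c ≤ k - 3) :
    Conn k 2 0 1 c 0 (k - c) := by
  have hodd : Odd k := Nat.odd_iff.2 (by omega)
  obtain ⟨q, hq⟩ : ∃ q, q + 1 = k / 2 := ⟨k / 2 - 1, by omega⟩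
  have h := conn_pass (α := 2) hodd (by omega) (by omega) (a := 1) (by omega)
    (by exact_mod_cast hc) hc' q (e := 0) (by push_cast; omega) (by omega) (by omega)
  rw [if_neg (by rw [Nat.even_iff]; omega)] at h
  refine (h.trans (conn_left_high hodd (by omega) le_rfl (by omega)
    (by omega) (by omega) (by omega) (by omega))).cast ?_ rfl (by ring)
  rw [natCast_zmod_three (q := q) (m := 0) (by omega)]
  decide

/-- Four returns close up: (0, c), (1, c+1), (0, k-c-1), (1, k-c), (0, c), costing 1, 0, 1, 0 modulo
3. -/
lemma good_two_zero (hk : k % 36 = 21) (hc : 3 ≤ c) (hc' : c ≤ k - 4) : Good k 2 0 c := by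
  refine ⟨2, by decide, ?_⟩
  have h1 := return_two_zero hk (c := c) (by omega) (by omega)
  have h2 := return_two_one hk (c := c + 1) (by omega) (by omega)
  have h3 := return_two_zero hk (c := k - (c + 1)) (by omega) (by omega)
  have h4 := return_two_one hk (c := k - (c + 1) + 1) (by omega) (by omega)
  exact (((h1.trans h2).trans h3).trans h4).cast (by decide) rfl (by ring)

lemma good_two_one (hk : k % 36 = 21) (hc : 4 ≤ c) (hc' : c ≤ k - 3) : Good k 2 1 c :=
  Good.of_conn (return_two_one hk (by omega) hc') (good_two_zero hk (by omega) (by omega))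

/-- In `conn_right` the last column would need e = α - 3 = -1. Instead it is mapped to itself by x ↦
k+1-x away from its top two tiles. -/
lemma good_two_last_column (hk : k % 36 = 21) (ha : 2 ≤ a) (ha' : a < k) : Good k 2 a k := by
  have hodd : Odd k := Nat.odd_iff.2 (by omega)
  have h : ∀ {x : ℤ}, 2 ≤ x → x < k → Conn k 2 1 x k (k + 1 - x) k := fun {x} h1 h2 =>
    Conn.of_step hodd (by omega) (by omega) (by omega) h2 (by omega) le_rfl
      (Or.inr (Or.inr (Or.inr ⟨rfl, Or.inr (Or.inr (Or.inl (by push_cast; omega)))⟩)))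
  exact ⟨2, by decide, ((h ha ha').trans (h (by omega) (by omega))).cast (by decide)
    (by ring) rfl⟩

lemma rects_two :
    rectEval (goodEval 21 2 1 4 fun _ _ => false) (0, 0) (0, 2) 2 2 = true ∧
    rectEval (goodEval 21 2 1 4 fun _ _ => false) (0, 0) (1, -3) 2 1 = true ∧
    rectEval (goodEval 21 2 1 4 fun _ _ => false) (0, 0) (0, 0) 3 2 = true ∧
    rectEval (goodEval 21 2 1 4 fun _ _ => false) (1, -4) (0, 0) 4 2 = true ∧
    rectEval (goodEval 21 2 1 4 fun _ _ => false) (0, 0) (1, -2) 5 3 = true ∧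
    rectEval (goodEval 21 2 1 4 fun _ _ => false) (1, -4) (1, -2) 4 3 = true := by
  decide +kernel

open Aff in
lemma allGood_two (hk : k % 36 = 21) : AllGood k 2 := by
  have hodd : Odd k := Nat.odd_iff.2 (by omega)
  have D : EvalData 21 2 1 4 k :=
    ⟨hodd, by omega, by omega, by omega, by omega, ⟨k / 2, by omega, by omega⟩, by omega⟩
  obtain ⟨r1, r2, r3, r4, r5, r6⟩ := rects_two
  have hkn : ∀ i j : Aff, (fun _ _ => false : Aff → Aff → Bool) i j = true →
      Good k 2 (ev k i) (ev k j) := by simp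
  have top : ∀ a c : ℤ, 0 ≤ a → a < 2 → 2 ≤ c → c ≤ k - 3 → Good k 2 a c := by
    intro a c ha ha' hc hc'
    -- The exceptional tiles lie in the columns α-2 and k-1, outside the range α, …, k-3.
    have hns : ¬ Special k 2 a c := by unfold Special; push_cast; omega
    by_cases h1 : c < 4
    · exact (good_of_rectEval D hkn r1 ha (by omega) (by omega) (by omega) (by simp [ev]; omega)
        (by simp [ev]; omega) (by simp [ev]; omega) (by simp [ev]; omega)).resolve_left hns
    by_cases h2 : k - 3 ≤ c
    · exact (good_of_rectEval D hkn r2 ha (by omega) (by omega) (by omega) (by simp [ev]; omega)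
        (by simp [ev]; omega) (by simp [ev]; omega) (by simp [ev]; omega)).resolve_left hns
    obtain rfl | rfl : a = 0 ∨ a = 1 := by omega
    · exact good_two_zero hk (by omega) (by omega)
    · exact good_two_one hk (by omega) (by omega)
  intro i j h1 h2 h3 h4
  by_cases hj : j < 2
  · by_cases hi : i < 3
    · exact good_of_rectEval D hkn r3 h1 h2 h3 h4 (by simp [ev]; omega) (by simp [ev]; omega)
        (by simp [ev]; omega) (by simp [ev]; omega)
    by_cases hi' : k - 4 ≤ i
    · exact good_of_rectEval D hkn r4 h1 h2 h3 h4 (by simp [ev]; omega) (by simp [ev]; omega)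
        (by simp [ev]; omega) (by simp [ev]; omega)
    exact Or.inr (Good.of_conn (conn_left_high hodd (by omega) le_rfl (by omega)
      (by push_cast; omega) (by omega) (by push_cast; omega) (by omega))
      (top _ _ h3 hj (by omega) (by omega)))
  by_cases hj' : j ≤ k - 3
  · obtain ⟨d, a, x, ha, ha', hx, hc⟩ := exists_conn_top (α := 2) hodd (by omega) (by omega)
      (by omega) h1 h2 (c := j) (by push_cast; omega) hj'
    push_cast at ha' hx
    exact Or.inr (Good.of_conn hc (top _ _ ha ha' (by omega) (by omega)))
  by_cases hi : i < 5
  · exact good_of_rectEval D hkn r5 h1 h2 h3 h4 (by simp [ev]; omega) (by simp [ev]; omega)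
      (by simp [ev]; omega) (by simp [ev]; omega)
  by_cases hi' : k - 4 ≤ i
  · exact good_of_rectEval D hkn r6 h1 h2 h3 h4 (by simp [ev]; omega) (by simp [ev]; omega)
      (by simp [ev]; omega) (by simp [ev]; omega)
  right
  by_cases hjk : j = k
  · rw [hjk]
    exact good_two_last_column hk (by omega) h2
  have := conn_right (α := 2) (e := k - 1 - j) hodd (by omega) (by omega) le_rfl (i := i)
    (by push_cast; omega) h2 (by omega) (by push_cast; omega) (by push_cast; omega)
  rw [show (k : ℤ) - 3 + (2 : ℕ) - (k - 1 - j) = j by push_cast; ring] at this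
  exact Good.of_conn this (top _ _ (by omega) (by omega) (by push_cast; omega)
    (by push_cast; omega))

end AlphaTwo

/-! ### The exponent α = 4, for k ≡ 3 modulo 72. -/

section AlphaFour

variable {k : ℕ} {a c : ℤ}

lemma return_four_lt (hk : k % 72 = 3) (hk4 : 4 ≤ k) (ha : 0 ≤ a) (ha' : a < 3) (hc : 5 ≤ c)
    (hc' : c ≤ k - 3) : Conn k 4 0 a c (a + 1) (c - 1) := by
  have hodd : Odd k := Nat.odd_iff.2 (by omega)
  obtain ⟨q, hq⟩ : ∃ q, q = k / 4 := ⟨_, rfl⟩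
  have h := conn_pass (α := 4) hodd (by omega) (by omega) ha (by push_cast; omega) hc'
    q (e := a + 1) (by push_cast; omega) (by omega) (by push_cast; omega)
  rw [if_pos (by rw [Nat.even_iff]; omega)] at h
  refine (h.trans (conn_left_high hodd (by omega) (by omega) (by push_cast; omega)
    (by push_cast; omega) (by omega) (by push_cast; omega) (by push_cast; omega))).cast ?_ rfl
      (by push_cast; ring)
  rw [natCast_zmod_three (q := q) (m := 0) (by omega)]
  decide

lemma return_four_three (hk : k % 72 = 3) (hk4 : 4 ≤ k) (hc : 4 ≤ c) (hc' : c ≤ k - 3) :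
    Conn k 4 1 3 c 0 (c + 3) := by
  have hodd : Odd k := Nat.odd_iff.2 (by omega)
  obtain ⟨q, hq⟩ : ∃ q, q + 1 = k / 4 := ⟨k / 4 - 1, by omega⟩
  have h := conn_pass (α := 4) hodd (by omega) (by omega) (a := 3) (by omega)
    (by push_cast; omega) hc' q (e := 0) (by push_cast; omega) (by omega) (by omega)
  rw [if_neg (by rw [Nat.even_iff]; omega)] at h
  refine (h.trans (conn_left_low hodd (by omega) (by omega) le_rfl (by norm_num)
    (by omega) (by push_cast; omega))).cast ?_ (by norm_num) (by push_cast; ring)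
  rw [natCast_zmod_three (q := q) (m := 2) (by omega)]
  decide

/-- The return map preserves a + c and runs cyclically through the four rows at total cost 1 modulo
3. The bounds on a + c keep the whole circuit within the columns 4, …, k-3. -/
lemma good_four (hk : k % 72 = 3) (hk4 : 4 ≤ k) (ha : 0 ≤ a) (ha' : a < 4) (hc : 7 ≤ a + c)
    (hc' : a + c ≤ k - 3) (hc4 : 4 ≤ c) : Good k 4 a c := by
  have h0 : ∀ {x : ℤ}, 7 ≤ x → x ≤ k - 3 → Good k 4 0 x := fun {x} h1 h2 => by
    refine ⟨1, by decide, ?_⟩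
    have e1 := return_four_lt hk hk4 (a := 0) (c := x) (by omega) (by omega) (by omega) (by omega)
    have e2 := return_four_lt hk hk4 (a := 0 + 1) (c := x - 1) (by omega) (by omega) (by omega)
      (by omega)
    have e3 := return_four_lt hk hk4 (a := 0 + 1 + 1) (c := x - 1 - 1) (by omega) (by omega)
      (by omega) (by omega)
    have e4 := return_four_three hk hk4 (c := x - 1 - 1 - 1) (by omega) (by omega)
    exact (((e1.trans e2).trans e3).trans e4).cast (by decide) rfl (by ring)
  have e3 : ∀ {x : ℤ}, 4 ≤ x → x ≤ k - 6 → Good k 4 3 x := fun {x} h1 h2 =>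
    Good.of_conn (return_four_three hk hk4 h1 (by omega)) (h0 (by omega) (by omega))
  have e2 : ∀ {x : ℤ}, 5 ≤ x → x ≤ k - 5 → Good k 4 2 x := fun {x} h1 h2 =>
    Good.of_conn (return_four_lt hk hk4 (by omega) (by omega) (by omega) (by omega))
      (e3 (by omega) (by omega))
  obtain rfl | rfl | rfl | rfl : a = 0 ∨ a = 1 ∨ a = 2 ∨ a = 3 := by omega
  · exact h0 (by omega) (by omega)
  · exact Good.of_conn (return_four_lt hk hk4 (by omega) (by omega) (by omega) (by omega))
      (e2 (by omega) (by omega))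
  · exact e2 (by omega) (by omega)
  · exact e3 (by omega) (by omega)

lemma rects_four :
    rectEval (goodEval 75 4 3 0 fun _ _ => false) (0, 0) (0, 4) 4 4 = true ∧
    rectEval (goodEval 75 4 3 0 fun _ _ => false) (0, 0) (1, -6) 4 4 = true ∧
    rectEval (goodEval 75 4 3 0 fun _ _ => false) (0, 0) (0, 0) 6 4 = true ∧
    rectEval (goodEval 75 4 3 0 fun _ _ => false) (1, -10) (0, 0) 10 4 = true ∧
    rectEval (goodEval 75 4 3 0 fun _ _ => false) (0, 0) (1, -2) 10 3 = true ∧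
    rectEval (goodEval 75 4 3 0 fun _ _ => false) (1, -8) (1, -2) 8 3 = true := by
  decide +kernel

open Aff in
lemma allGood_four (hk : k % 72 = 3) (hk4 : 4 ≤ k) : AllGood k 4 := by
  have hodd : Odd k := Nat.odd_iff.2 (by omega)
  have D : EvalData 75 4 3 0 k :=
    ⟨hodd, by omega, by omega, by omega, by omega, ⟨k / 4, by omega, by omega⟩, by omega⟩
  obtain ⟨r1, r2, r3, r4, r5, r6⟩ := rects_four
  have hkn : ∀ i j : Aff, (fun _ _ => false : Aff → Aff → Bool) i j = true →
      Good k 4 (ev k i) (ev k j) := by simp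
  have top : ∀ a c : ℤ, 0 ≤ a → a < 4 → 4 ≤ c → c ≤ k - 3 → Good k 4 a c := by
    intro a c ha ha' hc hc'
    have hns : ¬ Special k 4 a c := by unfold Special; push_cast; omega
    by_cases h1 : c < 8
    · exact (good_of_rectEval D hkn r1 ha (by omega) (by omega) (by omega) (by simp [ev]; omega)
        (by simp [ev]; omega) (by simp [ev]; omega) (by simp [ev]; omega)).resolve_left hns
    by_cases h2 : k - 6 ≤ c
    · exact (good_of_rectEval D hkn r2 ha (by omega) (by omega) (by omega) (by simp [ev]; omega)
        (by simp [ev]; omega) (by simp [ev]; omega) (by simp [ev]; omega)).resolve_left hns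
    exact good_four hk hk4 ha ha' (by omega) (by omega) hc
  intro i j h1 h2 h3 h4
  by_cases hj : j < 4
  · by_cases hi : i < 6
    · exact good_of_rectEval D hkn r3 h1 h2 h3 h4 (by simp [ev]; omega) (by simp [ev]; omega)
        (by simp [ev]; omega) (by simp [ev]; omega)
    by_cases hi' : k - 10 ≤ i
    · exact good_of_rectEval D hkn r4 h1 h2 h3 h4 (by simp [ev]; omega) (by simp [ev]; omega)
        (by simp [ev]; omega) (by simp [ev]; omega)
    right
    by_cases hj0 : j = 0
    · exact Good.of_conn (conn_left_low hodd (by omega) h1 h3 (by push_cast; omega)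
        (by omega) (by push_cast; omega))
        (top _ _ (by push_cast; omega) (by push_cast; omega) (by push_cast; omega)
          (by push_cast; omega))
    exact Good.of_conn (conn_left_high hodd (by omega) (by omega) (by omega)
      (by push_cast; omega) (by omega) (by push_cast; omega) (by push_cast; omega))
      (top _ _ h3 hj (by omega) (by omega))
  by_cases hj' : j ≤ k - 3
  · obtain ⟨d, a, x, ha, ha', hx, hc⟩ := exists_conn_top (α := 4) hodd (by omega) (by omega)
      (by omega) h1 h2 (c := j) (by push_cast; omega) hj'
    push_cast at ha' hx
    exact Or.inr (Good.of_conn hc (top _ _ ha ha' (by omega) (by omega)))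
  by_cases hi : i < 10
  · exact good_of_rectEval D hkn r5 h1 h2 h3 h4 (by simp [ev]; omega) (by simp [ev]; omega)
      (by simp [ev]; omega) (by simp [ev]; omega)
  by_cases hi' : k - 8 ≤ i
  · exact good_of_rectEval D hkn r6 h1 h2 h3 h4 (by simp [ev]; omega) (by simp [ev]; omega)
      (by simp [ev]; omega) (by simp [ev]; omega)
  have := conn_right (α := 4) (e := k + 1 - j) hodd (by omega) (by omega) (by omega) (i := i)
    (by push_cast; omega) h2 (by omega) (by push_cast; omega) (by push_cast; omega)
  rw [show (k : ℤ) - 3 + (4 : ℕ) - (k + 1 - j) = j by push_cast; ring] at this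
  exact Or.inr (Good.of_conn this (top _ _ (by omega) (by omega) (by push_cast; omega)
    (by push_cast; omega)))

end AlphaFour

/-! ### The exponent α = 12, for k ≡ 39 modulo 72. -/

section AlphaTwelve

variable {k : ℕ} {a c : ℤ}

lemma return_twelve_ge (hk : k % 72 = 39) (ha : 3 ≤ a) (ha' : a < 12) (hc : 20 ≤ c)
    (hc' : c ≤ k - 3) : Conn k 12 1 a c (11 - a) (k + 20 - c) := by
  have hodd : Odd k := Nat.odd_iff.2 (by omega)
  obtain ⟨q, hq⟩ : ∃ q, q + 1 = k / 12 := ⟨k / 12 - 1, by omega⟩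
  have h := conn_pass (α := 12) hodd (by omega) (by omega) (a := a) (by omega)
    (by push_cast; omega) hc' q (e := a - 3) (by push_cast; omega) (by omega) (by push_cast; omega)
  rw [if_pos (by rw [Nat.even_iff]; omega)] at h
  refine (h.trans (conn_left_low hodd (by omega) (by push_cast; omega) (by omega)
    (by push_cast; omega) (by push_cast; omega) (by push_cast; omega))).cast ?_
    (by push_cast; ring) (by push_cast; ring)
  rw [natCast_zmod_three (q := q) (m := 2) (by omega)]
  decide

lemma return_twelve_lt (hk : k % 72 = 39) (ha : 0 ≤ a) (ha' : a < 3) (hc : 12 ≤ c)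
    (hc' : c ≤ k - 12) : Conn k 12 0 a c (a + 9) (k - c) := by
  have hodd : Odd k := Nat.odd_iff.2 (by omega)
  obtain ⟨q, hq⟩ : ∃ q, q = k / 12 := ⟨_, rfl⟩
  have h := conn_pass (α := 12) hodd (by omega) (by omega) ha (by push_cast; omega) (by omega)
    q (e := a + 9) (by push_cast; omega) (by omega) (by push_cast; omega)
  rw [if_neg (by rw [Nat.even_iff]; omega)] at h
  refine (h.trans (conn_left_high hodd (by omega) (by omega) (by omega)
    (by push_cast; omega) (by omega) (by push_cast; omega) (by push_cast; omega))).cast ?_ rfl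
      (by ring)
  rw [natCast_zmod_three (q := q) (m := 0) (by omega)]
  decide

/-- The return map (a, c) ↦ (11-a, k+20-c) is an involution preserving the rows 3, …, 8; c ≥ 23
keeps the image column at most k-3. -/
lemma good_twelve_mid (hk : k % 72 = 39) (ha : 3 ≤ a) (ha' : a < 9) (hc : 23 ≤ c)
    (hc' : c ≤ k - 3) : Good k 12 a c :=
  ⟨2, by decide, ((return_twelve_ge hk ha (by omega) (by omega) hc').trans
    (return_twelve_ge hk (by omega) (by omega) (by omega) (by omega))).cast (by decide)
    (by ring) (by ring)⟩

/-- In the rows `0, 1, 2` a tile is moved along its row, or to the mirror row, by multiples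
of `20`. -/
lemma conn_twelve_jump (hk : k % 72 = 39) (ha : 0 ≤ a) (ha' : a < 3) (hc : 12 ≤ c) (n : ℕ)
    (hn : c + 20 * n ≤ k) :
    Conn k 12 n a c (if Even n then a else 2 - a) (c + 20 * n) := by
  induction n with
  | zero => simpa using Conn.refl ha (by omega) (by omega) (by omega)
  | succ n ih =>
    push_cast at hn
    have step : ∀ {x : ℤ}, 0 ≤ x → x < 3 → Conn k 12 1 x (c + 20 * n) (2 - x) (c + 20 * n + 20) :=
      fun {x} h1 h2 => ((return_twelve_lt hk h1 h2 (by omega) (by omega)).trans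
        (return_twelve_ge hk (by omega) (by omega) (by omega) (by omega))).cast (by decide)
        (by ring) (by ring)
    refine ((ih (by omega)).trans (step ?_ ?_)).cast (by push_cast; rfl) ?_ (by push_cast; ring)
    · split_ifs <;> omega
    · split_ifs <;> omega
    · by_cases h : Even n <;> simp [Nat.even_add_one, h]

/-- The tiles in the rows `0, 1, 2` and columns `12, …, 31`. -/
def inWindow (i j : Aff) : Bool :=
  i.1 = 0 ∧ 0 ≤ i.2 ∧ i.2 ≤ 2 ∧ j.1 = 0 ∧ 12 ≤ j.2 ∧ j.2 ≤ 31

/-- Where the orbit of the tile at `(a, k - u)` first returns to the window; the last component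
counts the steps modulo `3`. -/
def windowEntry (a u : ℕ) : ℕ × ℕ × ℕ :=
  if u < 3 then (2 - u, 31 - a, 1)
  else if 9 ≤ u ∧ u < 12 then (11 - u, 22 - a, 1)
  else (a, 31 - u, 0)

/-- The way from the last 20 columns back to the window does not depend on k, so a symbolic
computation covers all k at once. -/
lemma runEval_windowEntry : ∀ a < 3, ∀ u < 20,
    decide (runEval 39 12 3 3 inWindow 100 (0, Int.ofNat a) (1, -Int.ofNat u) 0 =
      some ((0, Int.ofNat (windowEntry a u).1), (0, Int.ofNat (windowEntry a u).2.1),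
        (windowEntry a u).2.2)) = true := by
  decide +kernel

/-- The first return to the window after a jump to the last `20` columns, for `k ≡ κ` modulo
`40`. -/
def windowNext (κ a c : ℕ) : ℕ × ℕ × ℕ :=
  -- This is k - c modulo 40, the added 40 avoiding truncation since c < 32. Its residue modulo 20
  -- is the final distance to column k; v < 20 means an even number of jumps.
  let v := (κ + 40 - c) % 40
  let w := windowEntry (if v < 20 then a else 2 - a) (v % 20)
  (w.1, w.2.1, c + v % 20 + w.2.2)

/-- Iterate `windowNext` until the state `(a₀, c₀)` comes back, and check that the number of steps
is prime to `3`. -/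
def windowLoop (κ a₀ c₀ : ℕ) : ℕ → ℕ → ℕ → ℕ → Bool
  | 0, _, _, _ => false
  | n + 1, a, c, s =>
    let w := windowNext κ a c
    if w.1 = a₀ ∧ w.2.1 = c₀ then (s + w.2.2) % 3 != 0
    else decide (w.1 < 3 ∧ 12 ≤ w.2.1 ∧ w.2.1 < 32) && windowLoop κ a₀ c₀ n w.1 w.2.1 (s + w.2.2)

/-- k ≡ 39 modulo 72 gives k ≡ 7 modulo 8, leaving five residues modulo 40. The bound 60 is the
number of tiles in the window. -/
lemma windowLoop_eq_true : ∀ m < 5, ∀ a < 3, ∀ b < 20,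
    windowLoop (8 * m + 7) a (12 + b) 60 a (12 + b) 0 = true := by
  decide +kernel

lemma evalData_twelve (hk : k % 72 = 39) : EvalData 39 12 3 3 k :=
  ⟨Nat.odd_iff.2 (by omega), by omega, by omega, by omega, by omega,
    ⟨k / 12, by omega, by omega⟩, by omega⟩

open Aff in
lemma conn_windowNext (hk : k % 72 = 39) {a c : ℕ} (ha : a < 3) (hc : 12 ≤ c) (hc' : c < 32) :
    Conn k 12 ((windowNext (k % 40) a c).2.2 : ℕ) a c (windowNext (k % 40) a c).1
      (windowNext (k % 40) a c).2.1 := by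
  obtain ⟨n, hn⟩ : ∃ n, n = (k - c) / 20 := ⟨_, rfl⟩
  obtain ⟨v, hv⟩ : ∃ v, v = (k % 40 + 40 - c) % 40 := ⟨_, rfl⟩
  have hkn : k = c + 20 * n + v % 20 := by omega
  have hev : Even n ↔ v < 20 := by rw [Nat.even_iff]; omega
  have h1 := conn_twelve_jump hk (a := a) (c := c) (by omega) (by omega) (by omega) n (by omega)
  obtain ⟨a', ha'⟩ : ∃ a' : ℕ, a' = if v < 20 then a else 2 - a := ⟨_, rfl⟩
  have ha3 : a' < 3 := by rw [ha']; split_ifs <;> omega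
  have e1 : (if Even n then (a : ℤ) else 2 - a) = a' := by
    simp only [hev, ha']; split_ifs <;> omega
  rw [e1] at h1
  have hu : v % 20 < 20 := Nat.mod_lt _ (by norm_num)
  have h0 : Conn k 12 (0 : ℕ) a' (k - (v % 20 : ℕ)) (ev k (0, Int.ofNat a'))
      (ev k (1, -Int.ofNat (v % 20))) :=
    (Conn.refl (by omega) (by omega) (by omega) (by omega)).cast (by simp) (by simp [ev])
      (by simp only [ev, Int.ofNat_eq_natCast]; ring)
  have h2 := (conn_of_runEval (evalData_twelve hk) 100 h0
    (of_decide_eq_true (runEval_windowEntry a' ha3 (v % 20) hu))).1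
  have hw : windowNext (k % 40) a c = ((windowEntry a' (v % 20)).1, (windowEntry a' (v % 20)).2.1,
      c + v % 20 + (windowEntry a' (v % 20)).2.2) := by
    simp only [windowNext, ← hv, ← ha']
  rw [hw]
  refine ((h1.cast rfl rfl (by omega)).trans h2).cast ?_ (by simp [ev]) (by simp [ev])
  -- From k = c + 20 n + v % 20 with 3 ∣ k and 20 ≡ -1 modulo 3, the number of jumps n is c + v % 20
  -- modulo 3.
  rw [natCast_zmod_three (q := n) (m := c + v % 20) (by omega)]
  push_cast
  rfl

lemma good_window (hk : k % 72 = 39) {a c : ℕ} (ha : a < 3) (hc : 12 ≤ c) (hc' : c < 32) :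
    Good k 12 a c := by
  have key : ∀ n (a' c' s : ℕ), a' < 3 → 12 ≤ c' → c' < 32 → Conn k 12 s a c a' c' →
      windowLoop (k % 40) a c n a' c' s = true → Good k 12 a c := by
    intro n
    induction n with
    | zero => intro a' c' s _ _ _ _ h; simp [windowLoop] at h
    | succ n ih =>
      intro a' c' s h1 h2 h3 hconn h
      have hnext := hconn.trans (conn_windowNext hk h1 h2 h3)
      simp only [windowLoop] at h
      split_ifs at h with hw
      · refine ⟨_, ?_, hnext.cast rfl (by rw [hw.1]) (by rw [hw.2])⟩
        simp only [bne_iff_ne, ne_eq] at h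
        rw [Ne, ← Nat.cast_add, ZMod.natCast_eq_zero_iff]
        omega
      · simp only [Bool.and_eq_true, decide_eq_true_eq] at h
        exact ih _ _ _ h.1.1 h.1.2.1 h.1.2.2 (hnext.cast (by push_cast; rfl) rfl rfl) h.2
  obtain ⟨b, rfl⟩ := Nat.exists_eq_add_of_le hc
  have hloop := windowLoop_eq_true (k % 40 / 8) (by omega) a ha b (by omega)
  rw [show 8 * (k % 40 / 8) + 7 = k % 40 by omega] at hloop
  exact key 60 a (12 + b) 0 ha hc hc'
    (by
      simpa using Conn.refl (k := k) (α := 12) (i := a) (j := (12 + b : ℕ)) (by omega) (by omega)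
        (by omega) (by omega)) hloop

open Aff in
lemma good_of_inWindow (hk : k % 72 = 39) (i j : Aff) (h : inWindow i j = true) :
    Good k 12 (ev k i) (ev k j) := by
  simp only [inWindow, decide_eq_true_eq] at h
  obtain ⟨h1, h2, h3, h4, h5, h6⟩ := h
  have := good_window hk (a := i.2.toNat) (c := j.2.toNat) (by omega) (by omega) (by omega)
  rw [Int.toNat_of_nonneg h2, Int.toNat_of_nonneg (by omega)] at this
  simpa [ev, h1, h4] using this

/-- The tile is traced back to the window by jumps of 20 columns; the mirroring a ↦ 2-a of the rows
is its own inverse. -/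
lemma good_twelve_low (hk : k % 72 = 39) (ha : 0 ≤ a) (ha' : a < 3) (hc : 12 ≤ c) (hc' : c ≤ k) :
    Good k 12 a c := by
  obtain ⟨n, hn⟩ := Int.eq_ofNat_of_zero_le (show 0 ≤ (c - 12) / 20 by omega)
  obtain ⟨x, hx⟩ := Int.eq_ofNat_of_zero_le (show 0 ≤ c - 20 * n by omega)
  obtain ⟨b, hb⟩ := Int.eq_ofNat_of_zero_le (show 0 ≤ if Even n then a else 2 - a by
    split_ifs <;> omega)
  have hb3 : b < 3 := by split_ifs at hb <;> omega
  have h := conn_twelve_jump hk (a := b) (c := x) (by omega) (by omega) (by omega) n (by omega)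
  have e : (if Even n then (b : ℤ) else 2 - b) = a := by
    split_ifs at hb ⊢ <;> omega
  rw [e, show (x : ℤ) + 20 * n = c by omega] at h
  exact Good.of_conn h.symm (good_window hk hb3 (by omega) (by omega))

lemma rects_twelve :
    rectEval (goodEval 39 12 3 3 inWindow) (0, 3) (0, 12) 9 11 = true ∧
    rectEval (goodEval 39 12 3 3 inWindow) (0, 0) (0, 0) 11 12 = true ∧
    rectEval (goodEval 39 12 3 3 inWindow) (1, -21) (0, 0) 21 12 = true ∧
    rectEval (goodEval 39 12 3 3 inWindow) (0, 0) (1, -2) 14 3 = true ∧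
    rectEval (goodEval 39 12 3 3 inWindow) (1, -8) (1, -2) 8 3 = true := by
  decide +kernel

open Aff in
lemma allGood_twelve (hk : k % 72 = 39) : AllGood k 12 := by
  have hodd : Odd k := Nat.odd_iff.2 (by omega)
  have D := evalData_twelve hk
  obtain ⟨r1, r2, r3, r4, r5⟩ := rects_twelve
  have hkn := good_of_inWindow hk
  have top : ∀ a c : ℤ, 0 ≤ a → a < 12 → 12 ≤ c → c ≤ k - 3 → Good k 12 a c := by
    intro a c ha ha' hc hc'
    have hns : ¬ Special k 12 a c := by unfold Special; push_cast; omega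
    by_cases h0 : a < 3
    · exact good_twelve_low hk ha h0 hc (by omega)
    by_cases h1 : c < 23
    · exact (good_of_rectEval D hkn r1 ha (by omega) (by omega) (by omega) (by simp [ev]; omega)
        (by simp [ev]; omega) (by simp [ev]; omega) (by simp [ev]; omega)).resolve_left hns
    by_cases h2 : a < 9
    · exact good_twelve_mid hk (by omega) h2 (by omega) hc'
    exact Good.of_conn (return_twelve_ge hk (by omega) ha' (by omega) hc')
      (good_twelve_low hk (by omega) (by omega) (by omega) (by omega))
  intro i j h1 h2 h3 h4
  by_cases hj : j < 12
  · by_cases hi : i < 11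
    · exact good_of_rectEval D hkn r2 h1 h2 h3 h4 (by simp [ev]; omega) (by simp [ev]; omega)
        (by simp [ev]; omega) (by simp [ev]; omega)
    by_cases hi' : k - 21 ≤ i
    · exact good_of_rectEval D hkn r3 h1 h2 h3 h4 (by simp [ev]; omega) (by simp [ev]; omega)
        (by simp [ev]; omega) (by simp [ev]; omega)
    right
    by_cases hj9 : j < 9
    · exact Good.of_conn (conn_left_low hodd (by omega) h1 h3 (by push_cast; omega)
        (by omega) (by push_cast; omega))
        (top _ _ (by push_cast; omega) (by push_cast; omega) (by push_cast; omega)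
          (by push_cast; omega))
    exact Good.of_conn (conn_left_high hodd (by omega) (by omega) (by omega)
      (by push_cast; omega) (by omega) (by push_cast; omega) (by push_cast; omega))
      (top _ _ h3 hj (by omega) (by omega))
  by_cases hj' : j ≤ k - 3
  · obtain ⟨d, a, x, ha, ha', hx, hc⟩ := exists_conn_top (α := 12) hodd (by omega) (by omega)
      (by omega) h1 h2 (c := j) (by push_cast; omega) hj'
    push_cast at ha' hx
    exact Or.inr (Good.of_conn hc (top _ _ ha ha' (by omega) (by omega)))
  by_cases hi : i < 14
  · exact good_of_rectEval D hkn r4 h1 h2 h3 h4 (by simp [ev]; omega) (by simp [ev]; omega)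
      (by simp [ev]; omega) (by simp [ev]; omega)
  by_cases hi' : k - 8 ≤ i
  · exact good_of_rectEval D hkn r5 h1 h2 h3 h4 (by simp [ev]; omega) (by simp [ev]; omega)
      (by simp [ev]; omega) (by simp [ev]; omega)
  have := conn_right (α := 12) (e := k + 9 - j) hodd (by omega) (by omega) (by omega) (i := i)
    (by push_cast; omega) h2 (by omega) (by push_cast; omega) (by push_cast; omega)
  rw [show (k : ℤ) - 3 + (12 : ℕ) - (k + 9 - j) = j by push_cast; ring] at this
  exact Or.inr (Good.of_conn this (top _ _ (by omega) (by omega) (by push_cast; omega)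
    (by push_cast; omega)))

end AlphaTwelve

lemma two_le_alphaExp (k : ℕ) : 2 ≤ alphaExp k := by
  unfold alphaExp; split_ifs <;> omega

lemma alphaExp_add_two_le {k : ℕ} (hk : Odd k) (hk3 : 3 < k) : alphaExp k + 2 ≤ k := by
  have := Nat.odd_iff.1 hk
  unfold alphaExp; split_ifs <;> omega

lemma allGood_alphaExp {k : ℕ} (hk : Odd k) (hk3 : 3 < k) : AllGood k (alphaExp k) := by
  have := Nat.odd_iff.1 hk
  unfold alphaExp
  split_ifs with h1 h2 h3
  · exact allGood_three hk hk3 h1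
  · exact allGood_four h2 hk3
  · exact allGood_two (by omega)
  · exact allGood_twelve (by omega)

/-! ### The even word in coordinates. -/

section Even

variable {k h : ℕ} {i j i' j' : ℤ}

lemma natCeil_div_four (k : ℕ) : ⌈(k : ℚ) / 4⌉₊ = (k + 3) / 4 := by
  apply le_antisymm
  · rw [Nat.ceil_le, div_le_iff₀ (by norm_num)]
    exact_mod_cast (by omega : k ≤ (k + 3) / 4 * 4)
  · rw [← Nat.lt_add_one_iff, Nat.div_lt_iff_lt_mul (by norm_num)]
    have : (k : ℚ) ≤ ⌈(k : ℚ) / 4⌉₊ * 4 := by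
      have := Nat.le_ceil ((k : ℚ) / 4)
      linarith
    have : k ≤ ⌈(k : ℚ) / 4⌉₊ * 4 := by exact_mod_cast this
    omega

/-- The square of `σ_R⁻¹ σ_L⁻¹` in coordinates: it moves border tiles only. -/
def BorderRel (k : ℕ) (i j i' j' : ℤ) : Prop :=
  (1 ≤ i ∧ 1 ≤ j ∧ j ≤ k - 1 ∧ i' = i ∧ j' = j) ∨
  (1 ≤ i ∧ j = 0 ∧ i' = 0 ∧ j' = k - i + 1) ∨
  (i = 0 ∧ j ≤ k - 2 ∧ i' = 1 + j ∧ j' = k) ∨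
  (i = 0 ∧ j = k - 1 ∧ i' = k - 1 ∧ j' = 0) ∨
  (i ≤ k - 2 ∧ j = k ∧ i' = k - 2 - i ∧ j' = 0) ∨
  (i = k - 1 ∧ j = k ∧ i' = 0 ∧ j' = 1)

lemma inv_mul_inv_moves
    (hr : (1 ≤ i ∧ j ≤ k - 1 ∧ i' = k - i ∧ j' = k - j) ∨
      (i = 0 ∧ j ≤ k - 1 ∧ i' = k - 1 - j ∧ j' = 0) ∨ (j = k ∧ i' = 0 ∧ j' = i + 1)) :
    Moves ((sigmaR k)⁻¹ * (sigmaL k)⁻¹) i j i' j' := by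
  intro t ht
  have := ht.bounds
  by_cases hj : j = k
  · exact (Moves.mul (i' := i) (j' := k) (sigmaL_inv_moves (by omega))
      (sigmaR_inv_moves (by omega))) t ht
  · exact (Moves.mul (i' := k - 1 - j) (j' := i) (sigmaL_inv_moves (by omega))
      (sigmaR_inv_moves (by omega))) t ht

lemma border_moves (hk : 2 ≤ k) (hr : BorderRel k i j i' j') :
    Moves (((sigmaR k)⁻¹ * (sigmaL k)⁻¹) ^ 2) i j i' j' := by
  intro t ht
  have := ht.bounds
  rw [pow_two]
  rcases hr with hr | hr | hr | hr | hr | hr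
  · exact (Moves.mul (i' := k - i) (j' := k - j) (inv_mul_inv_moves (by omega))
      (inv_mul_inv_moves (by omega))) t ht
  · exact (Moves.mul (i' := k - i) (j' := k) (inv_mul_inv_moves (by omega))
      (inv_mul_inv_moves (by omega))) t ht
  · exact (Moves.mul (i' := k - 1 - j) (j' := 0) (inv_mul_inv_moves (by omega))
      (inv_mul_inv_moves (by omega))) t ht
  · exact (Moves.mul (i' := 0) (j' := 0) (inv_mul_inv_moves (by omega))
      (inv_mul_inv_moves (by omega))) t ht
  · exact (Moves.mul (i' := 0) (j' := i + 1) (inv_mul_inv_moves (by omega))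
      (inv_mul_inv_moves (by omega))) t ht
  · exact (Moves.mul (i' := 0) (j' := k) (inv_mul_inv_moves (by omega))
      (inv_mul_inv_moves (by omega))) t ht

/-- The conjugate of the rotation by `(σ_R² σ_L²)^⌈k/4⌉` in coordinates, for `k = 2 h`: a rotation
of the four quadrants around the middle column. -/
def QuadrantRel (h : ℕ) (i j i' j' : ℤ) : Prop :=
  (h < j ∧ h ≤ i ∧ i' = j - h - 1 ∧ j' = 3 * h - i) ∨
  (h < j ∧ i < h ∧ i' = 3 * h - j ∧ j' = h - i - 1) ∨
  (j = h ∧ i' = i ∧ j' = j) ∨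
  (j < h ∧ i < h ∧ i' = j + h ∧ j' = i + 1 + h) ∨
  (j < h ∧ h ≤ i ∧ i' = h - 1 - j ∧ j' = i - h)

/-- Conjugation by the shift by 2n = h columns takes the fixed column 0 of σ_R to column h, and the
rows reflected on wrapping turn one rotation of a square into a rotation of quadrants. -/
lemma conj_shift_sigmaR_moves (hk : k = 2 * h) (n : ℕ) (hn : h = 2 * n)
    (hr : QuadrantRel h i j i' j') :
    Moves ((sigmaR k ^ 2 * sigmaL k ^ 2) ^ n * sigmaR k *
      ((sigmaR k ^ 2 * sigmaL k ^ 2) ^ n)⁻¹) i j i' j' := by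
  intro t ht
  have := ht.bounds
  rw [mul_assoc]
  have inv1 : ∀ {x y x' y' : ℤ}, 0 ≤ x → x < k → 0 ≤ y → y ≤ k →
      ((h ≤ y ∧ x' = x ∧ y' = y - h) ∨ (y < h ∧ x' = k - 1 - x ∧ y' = y + h + 1)) →
      Moves ((sigmaR k ^ 2 * sigmaL k ^ 2) ^ n)⁻¹ x y x' y' := fun h1 h2 h3 h4 h5 =>
    Moves.inv (by omega) (by omega) (by omega) (by omega)
      (shift_pow_moves n (by omega) (by omega))
  rcases hr with hr | hr | hr | hr | hr
  · exact (Moves.mul (Moves.mul (inv1 (x' := i) (y' := j - h) (by omega) (by omega) (by omega)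
      (by omega) (by omega)) (sigmaR_moves (i' := j - h - 1) (j' := k - i) (by omega)))
      (shift_pow_moves n (by omega) (by omega))) t ht
  · exact (Moves.mul (Moves.mul (inv1 (x' := i) (y' := j - h) (by omega) (by omega) (by omega)
      (by omega) (by omega)) (sigmaR_moves (i' := j - h - 1) (j' := k - i) (by omega)))
      (shift_pow_moves n (by omega) (by omega))) t ht
  · exact (Moves.mul (Moves.mul (inv1 (x' := i) (y' := 0) (by omega) (by omega) (by omega)
      (by omega) (by omega)) (sigmaR_moves (i' := i) (j' := 0) (by omega)))
      (shift_pow_moves n (by omega) (by omega))) t ht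
  · exact (Moves.mul (Moves.mul (inv1 (x' := k - 1 - i) (y' := j + h + 1) (by omega) (by omega)
      (by omega) (by omega) (by omega)) (sigmaR_moves (i' := j + h) (j' := i + 1) (by omega)))
      (shift_pow_moves n (by omega) (by omega))) t ht
  · exact (Moves.mul (Moves.mul (inv1 (x' := k - 1 - i) (y' := j + h + 1) (by omega) (by omega)
      (by omega) (by omega) (by omega)) (sigmaR_moves (i' := j + h) (j' := i + 1) (by omega)))
      (shift_pow_moves n (by omega) (by omega))) t ht

/-- Now 2n = h + 1, and the shift takes the fixed column k of σ_L to column h. The result is the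
same quadrant rotation, which explains the choice of σ₃ by k modulo 4. -/
lemma conj_shift_sigmaL_moves (hk : k = 2 * h) (n : ℕ) (hn : h + 1 = 2 * n)
    (hr : QuadrantRel h i j i' j') :
    Moves ((sigmaR k ^ 2 * sigmaL k ^ 2) ^ n * sigmaL k *
      ((sigmaR k ^ 2 * sigmaL k ^ 2) ^ n)⁻¹) i j i' j' := by
  intro t ht
  have := ht.bounds
  rw [mul_assoc]
  have inv1 : ∀ {x y x' y' : ℤ}, 0 ≤ x → x < k → 0 ≤ y → y ≤ k →
      ((h < y ∧ x' = x ∧ y' = y - h - 1) ∨ (y ≤ h ∧ x' = k - 1 - x ∧ y' = y + h)) →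
      Moves ((sigmaR k ^ 2 * sigmaL k ^ 2) ^ n)⁻¹ x y x' y' := fun h1 h2 h3 h4 h5 =>
    Moves.inv (by omega) (by omega) (by omega) (by omega)
      (shift_pow_moves n (by omega) (by omega))
  rcases hr with hr | hr | hr | hr | hr
  · exact (Moves.mul (Moves.mul (inv1 (x' := i) (y' := j - h - 1) (by omega) (by omega) (by omega)
      (by omega) (by omega)) (sigmaL_moves (i' := j - h - 1) (j' := k - 1 - i) (by omega)))
      (shift_pow_moves n (by omega) (by omega))) t ht
  · exact (Moves.mul (Moves.mul (inv1 (x' := i) (y' := j - h - 1) (by omega) (by omega) (by omega)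
      (by omega) (by omega)) (sigmaL_moves (i' := j - h - 1) (j' := k - 1 - i) (by omega)))
      (shift_pow_moves n (by omega) (by omega))) t ht
  · exact (Moves.mul (Moves.mul (inv1 (x' := k - 1 - i) (y' := k) (by omega) (by omega) (by omega)
      (by omega) (by omega)) (sigmaL_moves (i' := k - 1 - i) (j' := k) (by omega)))
      (shift_pow_moves n (by omega) (by omega))) t ht
  · exact (Moves.mul (Moves.mul (inv1 (x' := k - 1 - i) (y' := j + h) (by omega) (by omega)
      (by omega) (by omega) (by omega)) (sigmaL_moves (i' := j + h) (j' := i) (by omega)))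
      (shift_pow_moves n (by omega) (by omega))) t ht
  · exact (Moves.mul (Moves.mul (inv1 (x' := k - 1 - i) (y' := j + h) (by omega) (by omega)
      (by omega) (by omega) (by omega)) (sigmaL_moves (i' := j + h) (j' := i) (by omega)))
      (shift_pow_moves n (by omega) (by omega))) t ht

/-- The word for even `k = 2 h` in coordinates. -/
inductive EvenRel (h : ℕ) (i j i' j' : ℤ) : Prop
  | topLeft (hr : 1 ≤ i ∧ i < h ∧ 1 ≤ j ∧ j < h ∧ i' = j + h ∧ j' = i + 1 + h)
  | bottomLeft (hr : h ≤ i ∧ 1 ≤ j ∧ j < h ∧ i' = h - 1 - j ∧ j' = i - h)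
  | middle (hr : 1 ≤ i ∧ j = h ∧ i' = i ∧ j' = j)
  | topRight (hr : 1 ≤ i ∧ i < h ∧ h < j ∧ j < 2 * h ∧ i' = 3 * h - j ∧ j' = h - i - 1)
  | bottomRight (hr : h ≤ i ∧ h < j ∧ j < 2 * h ∧ i' = j - h - 1 ∧ j' = 3 * h - i)
  | leftUpper (hr : 1 ≤ i ∧ i ≤ h ∧ j = 0 ∧ i' = i - 1 + h ∧ j' = h - 1)
  | leftMiddle (hr : i = h + 1 ∧ j = 0 ∧ i' = 0 ∧ j' = h)
  | leftLower (hr : h + 2 ≤ i ∧ j = 0 ∧ i' = 3 * h + 1 - i ∧ j' = h + 1)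
  | topStart (hr : i = 0 ∧ j ≤ h - 2 ∧ i' = h ∧ j' = h - 2 - j)
  | topEnd (hr : i = 0 ∧ h - 1 ≤ j ∧ j ≤ 2 * h - 2 ∧ i' = h - 1 ∧ j' = 3 * h - 1 - j)
  | topCorner (hr : i = 0 ∧ j = 2 * h - 1 ∧ i' = h - 1 ∧ j' = h - 1)
  | rightUpper (hr : i ≤ h - 2 ∧ j = 2 * h ∧ i' = h - 1 ∧ j' = h - 2 - i)
  | rightLower (hr : h - 1 ≤ i ∧ i ≤ 2 * h - 2 ∧ j = 2 * h ∧ i' = h ∧ j' = 3 * h - 1 - i)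
  | rightCorner (hr : i = 2 * h - 1 ∧ j = 2 * h ∧ i' = h + 1 ∧ j' = h + 1)

lemma exists_borderRel_quadrantRel (hk : k = 2 * h) (h2 : 2 ≤ h) (hi : 0 ≤ i) (hi' : i < k)
    (hj : 0 ≤ j) (hj' : j ≤ k) (hr : EvenRel h i j i' j') :
    ∃ a b, BorderRel k i j a b ∧ QuadrantRel h a b i' j' := by
  have key : ∀ a b, BorderRel k i j a b → QuadrantRel h a b i' j' →
    ∃ a b, BorderRel k i j a b ∧ QuadrantRel h a b i' j' := fun a b h1 h2 => ⟨a, b, h1, h2⟩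
  unfold QuadrantRel at key
  rcases hr with hr | hr | hr | hr | hr | hr | hr | hr | hr | hr | hr | hr | hr | hr
  iterate 5 exact key i j (Or.inl (by omega)) (by omega)
  iterate 3 exact key 0 (k - i + 1) (Or.inr (Or.inl (by omega))) (by omega)
  iterate 2 exact key (1 + j) k (Or.inr (Or.inr (Or.inl (by omega)))) (by omega)
  · exact key (k - 1) 0 (Or.inr (Or.inr (Or.inr (Or.inl (by omega))))) (by omega)
  iterate 2 exact key (k - 2 - i) 0 (Or.inr (Or.inr (Or.inr (Or.inr (Or.inl
      (by omega)))))) (by omega)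
  · exact key 0 1 (Or.inr (Or.inr (Or.inr (Or.inr (Or.inr (by omega)))))) (by omega)

lemma evenWord_moves (hk : k = 2 * h) (h2 : 2 ≤ h) (hr : EvenRel h i j i' j') :
    Moves (evenWord k (sigmaL k) (sigmaR k)) i j i' j' := by
  intro t ht
  obtain ⟨b1, b2, b3, b4⟩ := ht.bounds
  obtain ⟨a, b, hb, hq⟩ := exists_borderRel_quadrantRel hk h2 b1 b2 b3 b4 hr
  refine Moves.mul (border_moves (by omega) hb) ?_ t ht
  rw [natCeil_div_four]
  by_cases h4 : k % 4 = 0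
  · rw [if_pos h4]
    exact conj_shift_sigmaR_moves hk _ (by omega) hq
  · rw [if_neg h4]
    exact conj_shift_sigmaL_moves hk _ (by omega) hq

end Even

/-! ### The cycles of the even word. -/

section EvenCycles

variable {k h : ℕ} {i j i' j' : ℤ}

/-- The twentieth power of the word for even `k` fixes the tile at `(i, j)`. -/
def Fixed (k : ℕ) (i j : ℤ) : Prop :=
  Moves (evenWord k (sigmaL k) (sigmaR k) ^ 20) i j i j

lemma Fixed.of_moves (hm : Moves (evenWord k (sigmaL k) (sigmaR k)) i j i' j')
    (hf : Fixed k i' j') : Fixed k i j := by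
  intro t ht
  have h1 := hf.apply_eq (hm t ht)
  rw [← Equiv.Perm.mul_apply, ← pow_succ, pow_succ', Equiv.Perm.mul_apply] at h1
  rw [(evenWord k (sigmaL k) (sigmaR k)).injective h1]
  exact ht

lemma Moves.pow_self {f : Equiv.Perm (Tile k)} (hm : Moves f i j i j) (n : ℕ) :
    Moves (f ^ n) i j i j := by
  induction n with
  | zero => exact Moves.one
  | succ n ih => rw [pow_succ]; exact hm.mul ih

lemma Fixed.step (hk : k = 2 * h) (h2 : 2 ≤ h) (hr : EvenRel h i j i' j') (hf : Fixed k i' j') :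
    Fixed k i j :=
  Fixed.of_moves (evenWord_moves hk h2 hr) hf

lemma fixed_of_cycle_four (hk : k = 2 * h) (h2 : 2 ≤ h) {i₁ j₁ i₂ j₂ i₃ j₃ : ℤ}
    (e1 : EvenRel h i j i₁ j₁) (e2 : EvenRel h i₁ j₁ i₂ j₂) (e3 : EvenRel h i₂ j₂ i₃ j₃)
    (e4 : EvenRel h i₃ j₃ i j) : Fixed k i j := by
  have h5 := ((((evenWord_moves hk h2 e1).mul (evenWord_moves hk h2 e2)).mul
    (evenWord_moves hk h2 e3)).mul (evenWord_moves hk h2 e4)).pow_self 5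
  unfold Fixed
  rw [show ∀ f : Equiv.Perm (Tile k), f ^ 20 = (f * (f * (f * f))) ^ 5 from fun f => by
    simp only [← pow_succ', ← pow_two, ← pow_mul]]
  exact h5

/-- The one orbit followed for ten steps, responsible for the factor 5 in the exponent 20. Only the
members used below are recorded. -/
lemma fixed_of_cycle_ten (hk : k = 2 * h) (h2 : 2 ≤ h) :
    Fixed k 0 (h - 2) ∧ Fixed k h 0 ∧ Fixed k 0 (h - 1) ∧ Fixed k (h - 1) (2 * h) ∧
      Fixed k h (2 * h) ∧ Fixed k (h - 1) 0 := by
  have e0 : EvenRel h 0 (h - 2) h 0 := .topStart (by omega)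
  have e1 : EvenRel h h 0 (2 * h - 1) (h - 1) := .leftUpper (by omega)
  have e2 : EvenRel h (2 * h - 1) (h - 1) 0 (h - 1) := .bottomLeft (by omega)
  have e3 : EvenRel h 0 (h - 1) (h - 1) (2 * h) := .topEnd (by omega)
  have e4 : EvenRel h (h - 1) (2 * h) h (2 * h) := .rightLower (by omega)
  have e5 : EvenRel h h (2 * h) h (2 * h - 1) := .rightLower (by omega)
  have e6 : EvenRel h h (2 * h - 1) (h - 2) (2 * h) := .bottomRight (by omega)
  have e7 : EvenRel h (h - 2) (2 * h) (h - 1) 0 := .rightUpper (by omega)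
  have e8 : EvenRel h (h - 1) 0 (2 * h - 2) (h - 1) := .leftUpper (by omega)
  have e9 : EvenRel h (2 * h - 2) (h - 1) 0 (h - 2) := .bottomLeft (by omega)
  have m : ∀ {a b a' b' : ℤ}, EvenRel h a b a' b' →
      Moves (evenWord k (sigmaL k) (sigmaR k)) a b a' b' := evenWord_moves hk h2
  have f0 : Fixed k 0 (h - 2) := by
    have h5 := ((((((((((m e0).mul (m e1)).mul (m e2)).mul (m e3)).mul (m e4)).mul (m e5)).mul
      (m e6)).mul (m e7)).mul (m e8)).mul (m e9)).pow_self 2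
    unfold Fixed
    generalize evenWord k (sigmaL k) (sigmaR k) = f at h5 ⊢
    simp only [← pow_succ', ← pow_two, ← pow_mul] at h5
    exact h5
  have f9 := Fixed.step hk h2 e9 f0
  have f8 := Fixed.step hk h2 e8 f9
  have f7 := Fixed.step hk h2 e7 f8
  have f6 := Fixed.step hk h2 e6 f7
  have f5 := Fixed.step hk h2 e5 f6
  have f4 := Fixed.step hk h2 e4 f5
  have f3 := Fixed.step hk h2 e3 f4
  have f2 := Fixed.step hk h2 e2 f3
  have f1 := Fixed.step hk h2 e1 f2
  exact ⟨f0, f1, f3, f4, f5, f8⟩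

lemma fixed_top_left (hk : k = 2 * h) (h2 : 2 ≤ h) (hi : 0 ≤ i) (hi' : i < h) (hj : 0 ≤ j)
    (hj' : j < h) : Fixed k i j := by
  obtain ⟨f0, f1, f2, f3, f4, f5⟩ := fixed_of_cycle_ten hk h2
  have left : ∀ {x : ℤ}, 1 ≤ x → x ≤ h - 2 → Fixed k x 0 := fun {x} h3 h4 => by
    exact fixed_of_cycle_four hk h2 (i₁ := x - 1 + h) (j₁ := h - 1) (i₂ := 0) (j₂ := x - 1)
      (i₃ := h) (j₃ := h - 1 - x)
      (.leftUpper (by omega)) (.bottomLeft (by omega)) (.topStart (by omega)) (.bottomLeft (by omega))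
  by_cases hi0 : i = 0
  · subst hi0
    by_cases h3 : j = h - 1
    · rwa [h3]
    by_cases h4 : j = h - 2
    · rwa [h4]
    exact Fixed.step hk h2 (i' := h) (j' := h - 2 - j) (.topStart (by omega))
      (Fixed.step hk h2 (i' := j + 1) (j' := 0) (.bottomLeft (by omega))
        (left (by omega) (by omega)))
  by_cases hj0 : j = 0
  · subst hj0
    by_cases h3 : i = h - 1
    · rwa [h3]
    · exact left (by omega) (by omega)
  by_cases h3 : i ≤ h - 2
  · exact fixed_of_cycle_four hk h2 (i₁ := j + h) (j₁ := i + 1 + h) (i₂ := i) (j₂ := 2 * h - j)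
      (i₃ := j + h) (j₃ := h - 1 - i)
      (.topLeft (by omega)) (.bottomRight (by omega)) (.topRight (by omega)) (.bottomLeft (by omega))
  obtain rfl : i = h - 1 := by omega
  by_cases h4 : j ≤ h - 2
  · exact fixed_of_cycle_four hk h2 (i₁ := j + h) (j₁ := 2 * h) (i₂ := h) (j₂ := 2 * h - 1 - j)
      (i₃ := h - 2 - j) (j₃ := 2 * h)
      (.topLeft (by omega)) (.rightLower (by omega)) (.bottomRight (by omega)) (.rightUpper (by omega))
  · exact fixed_of_cycle_four hk h2 (i₁ := 2 * h - 1) (j₁ := 2 * h) (i₂ := h + 1) (j₂ := h + 1)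
      (i₃ := 0) (j₃ := 2 * h - 1)
      (.topLeft (by omega)) (.rightCorner (by omega)) (.bottomRight (by omega)) (.topCorner (by omega))

/-- Fixedness is pulled back along the word: each region maps into ones already settled, starting
from the top left quadrant, unless it closes up by itself. -/
lemma fixed_of_not_special (hk : k = 2 * h) (h2 : 2 ≤ h) (hi : 0 ≤ i) (hi' : i < k) (hj : 0 ≤ j)
    (hj' : j ≤ k) (h3 : ¬ (i = 0 ∧ j = h)) (h4 : ¬ (i = h - 1 ∧ j = k - 1))
    (h5 : ¬ (i = h + 1 ∧ j = 0)) : Fixed k i j := by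
  obtain ⟨f0, f1, f2, f3, f4, f5⟩ := fixed_of_cycle_ten hk h2
  have tl : ∀ {x y : ℤ}, 0 ≤ x → x < h → 0 ≤ y → y < h → Fixed k x y := fun a b c d =>
    fixed_top_left hk h2 a b c d
  have bl : ∀ {x y : ℤ}, h ≤ x → x < k → 0 ≤ y → y < h → ¬ (x = h + 1 ∧ y = 0) →
      Fixed k x y := fun {x y} a b c d e => by
    by_cases hy : y = 0
    · subst hy
      by_cases hx : x = h
      · rwa [hx]
      exact fixed_of_cycle_four hk h2 (i₁ := 3 * h + 1 - x) (j₁ := h + 1) (i₂ := 0) (j₂ := x - 1)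
        (i₃ := h - 1) (j₃ := 3 * h - x)
        (.leftLower (by omega)) (.bottomRight (by omega)) (.topEnd (by omega)) (.topRight (by omega))
    · exact Fixed.step hk h2 (i' := h - 1 - y) (j' := x - h) (.bottomLeft (by omega))
        (tl (by omega) (by omega) (by omega) (by omega))
  have tr : ∀ {x y : ℤ}, 1 ≤ x → x < h → h < y → y < k → ¬ (x = h - 1 ∧ y = k - 1) →
      Fixed k x y := fun {x y} a b c d e =>
    Fixed.step hk h2 (i' := 3 * h - y) (j' := h - x - 1) (.topRight (by omega))
      (bl (by omega) (by omega) (by omega) (by omega) (by omega))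
  have tr0 : ∀ {y : ℤ}, h < y → y < k → Fixed k 0 y := fun {y} a b => by
    by_cases hy : y = k - 1
    · exact Fixed.step hk h2 (i' := h - 1) (j' := h - 1) (.topCorner (by omega))
        (tl (by omega) (by omega) (by omega) (by omega))
    · exact Fixed.step hk h2 (i' := h - 1) (j' := 3 * h - 1 - y) (.topEnd (by omega))
        (tr (by omega) (by omega) (by omega) (by omega) (by omega))
  have last : ∀ {x : ℤ}, 0 ≤ x → x ≤ h - 2 → Fixed k x (2 * h) := fun {x} a b =>
    Fixed.step hk h2 (i' := h - 1) (j' := h - 2 - x) (.rightUpper (by omega))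
      (tl (by omega) (by omega) (by omega) (by omega))
  have br : ∀ {x y : ℤ}, h ≤ x → x < k → h < y → y < k → Fixed k x y := fun {x y} a b c d => by
    refine Fixed.step hk h2 (i' := y - h - 1) (j' := 3 * h - x) (.bottomRight (by omega)) ?_
    by_cases hx : x = h
    · rw [hx, show 3 * (h : ℤ) - h = 2 * h by ring]
      exact last (by omega) (by omega)
    by_cases hy : y = h + 1
    · rw [hy, show (h : ℤ) + 1 - h - 1 = 0 by ring]
      exact tr0 (by omega) (by omega)
    · exact tr (by omega) (by omega) (by omega) (by omega) (by omega)
  obtain hjh | hjh | hjh | hjh : j < h ∨ j = h ∨ (h < j ∧ j < k) ∨ j = 2 * h := by omega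
  · by_cases hih : i < h
    · exact tl hi hih hj hjh
    · exact bl (by omega) hi' hj hjh h5
  · have : EvenRel h i j i j := .middle (by omega)
    exact (evenWord_moves hk h2 this).pow_self 20
  · by_cases hi0 : i = 0
    · rw [hi0]
      exact tr0 hjh.1 hjh.2
    by_cases hih : i < h
    · exact tr (by omega) hih hjh.1 hjh.2 h4
    · exact br (by omega) hi' hjh.1 hjh.2
  · subst hjh
    by_cases h6 : i ≤ h - 2
    · exact last hi h6
    by_cases h7 : i = h - 1
    · rwa [h7]
    by_cases h8 : i = h
    · rwa [h8]
    by_cases h9 : i = k - 1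
    · exact Fixed.step hk h2 (i' := h + 1) (j' := h + 1) (.rightCorner (by omega))
        (br (by omega) (by omega) (by omega) (by omega))
    · exact Fixed.step hk h2 (i' := h) (j' := 3 * h - 1 - i) (.rightLower (by omega))
        (br (by omega) (by omega) (by omega) (by omega))

lemma isThreeCycle_evenWord (hk : Even k) (hk3 : 3 < k) :
    (evenWord k (sigmaL k) (sigmaR k) ^ 20).IsThreeCycle := by
  obtain ⟨h, hh⟩ := hk
  have hk' : k = 2 * h := by omega
  have h2 : 2 ≤ h := by omega
  obtain ⟨a, ha⟩ := exists_atPos (k := k) (i := 0) (j := h)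
    (by omega) (by omega) (by omega) (by omega)
  obtain ⟨b, hb⟩ := exists_atPos (k := k) (i := h - 1) (j := 2 * h - 1)
    (by omega) (by omega) (by omega) (by omega)
  obtain ⟨c, hc⟩ := exists_atPos (k := k) (i := h + 1) (j := 0)
    (by omega) (by omega) (by omega) (by omega)
  have hne : a ≠ b ∧ a ≠ c ∧ b ≠ c := by
    refine ⟨?_, ?_, ?_⟩ <;> rintro rfl
    · have := ha.1.symm.trans hb.1; omega
    · have := ha.1.symm.trans hc.1; omega
    · have := hb.1.symm.trans hc.1; omega
  have e1 : EvenRel h 0 h (h - 1) (2 * h - 1) := .topEnd (by omega)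
  have e2 : EvenRel h (h - 1) (2 * h - 1) (h + 1) 0 := .topRight (by omega)
  have e3 : EvenRel h (h + 1) 0 0 h := .leftMiddle (by omega)
  have hab := (evenWord_moves hk' h2 e1 a ha).unique hb
  have hbc := (evenWord_moves hk' h2 e2 b hb).unique hc
  have hca := (evenWord_moves hk' h2 e3 c hc).unique ha
  refine (isThreeCycle_of_fixes_compl hne.1 hne.2.1 hne.2.2
    (pow_apply_ne_of_three_cycle hab hbc hca hne.1 hne.2.1 (by norm_num))
    (pow_apply_ne_of_three_cycle hbc hca hab hne.2.2 hne.1.symm (by norm_num))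
    (pow_apply_ne_of_three_cycle hca hab hbc hne.2.1.symm hne.2.2.symm (by norm_num)) ?_).1
  intro t hta htb htc
  have ht : AtPos t t.1 t.2 := ⟨rfl, rfl⟩
  obtain ⟨b1, b2, b3, b4⟩ := ht.bounds
  refine Moves.apply_eq (fixed_of_not_special hk' h2 b1 b2 b3 b4 ?_ ?_ ?_) ht
  · exact fun hs => hta (AtPos.unique ⟨hs.1, hs.2⟩ ha)
  · exact fun hs => htb (AtPos.unique ⟨hs.1, by rw [hs.2]; omega⟩ hb)
  · exact fun hs => htc (AtPos.unique ⟨hs.1, hs.2⟩ hc)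

end EvenCycles

/-! ### Membership in the puzzle group and the final assembly. -/

section Group

variable {k : ℕ}

lemma evenWord_mem (k : ℕ) : evenWord k (sigmaL k) (sigmaR k) ∈ puzzleGroup k := by
  have hl : sigmaL k ∈ puzzleGroup k := Subgroup.subset_closure (by simp)
  have hr : sigmaR k ∈ puzzleGroup k := Subgroup.subset_closure (by simp)
  have hy : (sigmaR k ^ 2 * sigmaL k ^ 2) ^ ⌈(k : ℚ) / 4⌉₊ ∈ puzzleGroup k :=
    pow_mem (mul_mem (pow_mem hr 2) (pow_mem hl 2)) _
  refine mul_mem (mul_mem (mul_mem hy ?_) (inv_mem hy))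
    (pow_mem (mul_mem (inv_mem hr) (inv_mem hl)) 2)
  split_ifs
  · exact hr
  · exact hl

lemma oddWord_mem (k : ℕ) : oddWord k (sigmaL k) (sigmaR k) ∈ puzzleGroup k := by
  have hl : sigmaL k ∈ puzzleGroup k := Subgroup.subset_closure (by simp)
  have hr : sigmaR k ∈ puzzleGroup k := Subgroup.subset_closure (by simp)
  exact mul_mem (mul_mem (pow_mem (mul_mem (inv_mem hr) hl) _)
    (pow_mem (mul_mem (pow_mem hr 2) (pow_mem hl 2)) _)) (pow_mem hl 2)

end Group

theorem lemma2 (k : ℕ) (hk : 3 < k) :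
    (∃ g ∈ puzzleGroup k, g.IsThreeCycle) ∧
    (Even k → ((evenWord k (sigmaL k) (sigmaR k)) ^ 20).IsThreeCycle) ∧
    (Odd k →
      -- the order `β` is divisible by `3`, for the word and for the word with `σ_L`, `σ_R` swapped
      3 ∣ orderOf (oddWord k (sigmaL k) (sigmaR k)) ∧
      3 ∣ orderOf (oddWord k (sigmaR k) (sigmaL k)) ∧
      -- the `β/3`-th powers are `3`-cycles
      ((oddWord k (sigmaL k) (sigmaR k)) ^
        (orderOf (oddWord k (sigmaL k) (sigmaR k)) / 3)).IsThreeCycle ∧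
      ((oddWord k (sigmaR k) (sigmaL k)) ^
        (orderOf (oddWord k (sigmaR k) (sigmaL k)) / 3)).IsThreeCycle ∧
      -- they move tiles of opposite colours
      ∃ c : ZMod 2,
        (((oddWord k (sigmaL k) (sigmaR k)) ^
          (orderOf (oddWord k (sigmaL k) (sigmaR k)) / 3)).support : Set (Tile k))
            ⊆ colourClass k c ∧
        (((oddWord k (sigmaR k) (sigmaL k)) ^
          (orderOf (oddWord k (sigmaR k) (sigmaL k)) / 3)).support : Set (Tile k))
            ⊆ colourClass k (c + 1)) := by
  have hodd := fun h : Odd k => odd_case_of_allGood h (two_le_alphaExp k)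
    (alphaExp_add_two_le h hk) (allGood_alphaExp h hk)
  refine ⟨?_, fun h => isThreeCycle_evenWord h hk, hodd⟩
  rcases Nat.even_or_odd k with h | h
  · exact ⟨_, pow_mem (evenWord_mem k) 20, isThreeCycle_evenWord h hk⟩
  · exact ⟨_, pow_mem (oddWord_mem k) _, (hodd h).2.2.1⟩
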